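/- Let $A$ be a unital associative, not necessarily commutative ring, let $N=\{1,\dots,n\}$ with $n\ge 3$ or $N=\mathbb N$, and let $N=I\sqcup J$ be a partition with $I$ and $J$ non-empty. Write $[g,h]=ghg^{-1}h^{-1}$ for the group commutator. **Linear groups.** The linear Steinberg group $\mathrm{St}_N(A)$ is the group presented by generators $x_{ij}(a)$ ($i\ne j$ in $N$, $a\in A$) and the relations $x_{ij}(a)x_{ij}(b)=x_{ij}(a+b)$; $[x_{ij}(a),x_{kl}(b)]=1$ if $j\ne k$ and $l\ne i$; and $[x_{ij}(a),x_{jl}(b)]=x_{il}(ab)$ if $i,j,l$ are pairwise distinct. Let $\mathrm{EL}_N(A)$ be the group generated by the elementary matrices $e_{ij}(a)=\mathbf 1+aE_{ij}$ ($i\ne j$ in $N$, $a\in A$) in the group of units of the ring $\mathbb Z\mathbf 1+\mathrm{Mat}_N(A)$, where $\mathrm{Mat}_N(A)$ is the set of $N\times N$-matrices with finitely many non-zero entries; put $\mathrm{EL}(A)=\mathrm{EL}_{\mathbb N}(A)$. Let $\wp_N:\mathrm{St}_N(A)\to \mathrm{EL}_N(A)$ be the homomorphism with $x_{ij}(a)\mapsto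 e_{ij}(a)$. **The Jordan-style Steinberg group.** Let $V^+=\mathrm{Mat}_{IJ}(A)$ and $V^-=\mathrm{Mat}_{JI}(A)$ be the additive groups of $I\times J$- and $J\times I$-matrices over $A$ with finitely many non-zero entries, with triple products $\{x\,y\,z\}=xyz+zyx$ for $x,z\in V^\sigma$, $y\in V^{-\sigma}$, $\sigma\in\{+,-\}$. In the real inner product space with orthonormal basis $(\varepsilon_i)_{i\in N}$ let $R_1=\{\varepsilon_i-\varepsilon_j: i\in I,\ j\in J\}$, and for $\alpha=\varepsilon_i-\varepsilon_j\in R_1$ let $V_\alpha^+=AE_{ij}$ and $V_\alpha^-=AE_{ji}$. The group $\mathrm{St}(\mathbb M_{IJ}(A),\mathfrak R)$ is presented by generators $x_+(u)$ ($u\in V^+$) and $x_-(v)$ ($v\in V^-$) and the relations, for $\sigma\in\{+,-\}$, * (EJ1) $x_\sigma(u+u')=x_\sigma(u)\,x_\sigma(u')$ for $u,u'\in V^\sigma$; * (EJ2) $[x_+(u),x_-(v)]=1$ for $u\in V_\alpha^+$, $v\in V_\beta^-$, where $\alpha,\beta\in R_1$ and $(\alpha\,|\,\beta)=0$; * (EJ3)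 $[[x_\sigma(u),x_{-\sigma}(v)],x_\sigma(z)]=x_\sigma(-\{u\,v\,z\})$ for $u\in V_\alpha^\sigma$, $v\in V_\beta^{-\sigma}$, $z\in V^\sigma$, where $\alpha,\beta\in R_1$ and $(\alpha\,|\,\beta)=1$. Let $\Phi:\mathrm{St}(\mathbb M_{IJ}(A),\mathfrak R)\to \mathrm{St}_N(A)$ be the homomorphism with $x_+(u)\mapsto\prod_{(i,j)\in I\times J}x_{ij}(u_{ij})$ and $x_-(v)\mapsto\prod_{(i,j)\in I\times J}x_{ji}(-v_{ji})$ (the factors of each product commute and almost all of them are $1$), and put $p_N=\wp_N\circ\Phi$. **Central extensions.** A central extension of a group $G$ is a surjective homomorphism $p:E\to G$ whose kernel lies in the centre of $E$. A central extension $q:X\to G$ is universal if for every central extension $p:E\to G$ there is a unique homomorphism $f:X\to E$ with $q=p\circ f$. A group $X$ is centrally closed if $\mathrm{id}_X$ is a universal central extension. **Theorem 1.6.** The map $\Phi$ is an isomorphism of groups. In particular, $\mathrm{St}(\mathbb M_{IJ}(A),\mathfrak R)$ is centrally closed if $|N|\ge 5$, and $p_N:\mathrm{St}(\mathbb M_{IJ}(A),\mathfrak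 R)\to\mathrm{EL}(A)$ is a universal central extension if $N=\mathbb N$. -/

import Mathlib

universe u v w

noncomputable section

namespace JordanSteinberg

open scoped commutatorElement

/-! ### Central extensions -/

/-- A central extension of `G`: a surjective homomorphism with central kernel. -/
def IsCentralExtension {E : Type u} {G : Type v} [Group E] [Group G] (p : E →* G) : Prop :=
  Function.Surjective p ∧ p.ker ≤ Subgroup.center E

/-- A universal central extension `q : X → G`: a central extension such that for every central
extension `p : E → G` there is a unique homomorphism `f : X → E` with `q = p ∘ f`.
The groups `E` range over the universe `w`. -/
def IsUniversalCentralExtension {X : Type u} {G : Type v} [Group X] [Group G]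
    (q : X →* G) : Prop :=
  IsCentralExtension q ∧
    ∀ (E : Type w) [Group E] (p : E →* G), IsCentralExtension p → ∃! f : X →* E, q = p.comp f

/-- A group is centrally closed if its identity map is a universal central extension. -/
def IsCentrallyClosed (X : Type u) [Group X] : Prop :=
  IsUniversalCentralExtension.{u, u, w} (MonoidHom.id X)

/-! ### Matrices with finitely many non-zero entries -/

/-- `I × J`-matrices over `A` with only finitely many non-zero entries; the matrix `a E_{ij}`
is `Finsupp.single (i, j) a`. -/
abbrev FinMat (I J A : Type*) [Zero A] : Type _ := (I × J) →₀ A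

/-- Matrix multiplication: the bilinear operation with `a E_{ij} * b E_{kl} = δ_{jk} ab E_{il}`. -/
def FinMat.mul {I J K A : Type*} [Ring A] [DecidableEq J] (x : FinMat I J A) (y : FinMat J K A) :
    FinMat I K A :=
  x.sum fun p a => y.sum fun q b =>
    if p.2 = q.1 then Finsupp.single (p.1, q.2) (a * b) else 0

/-- The Jordan triple product `{x y z} = xyz + zyx`. -/
def FinMat.triple {I J A : Type*} [Ring A] [DecidableEq I] [DecidableEq J]
    (x : FinMat I J A) (y : FinMat J I A) (z : FinMat I J A) : FinMat I J A :=
  FinMat.mul (FinMat.mul x y) z + FinMat.mul (FinMat.mul z y) x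

theorem FinMat.mul_single {I J K A : Type*} [Ring A] [DecidableEq J] (i : I) (j l : J) (k : K)
    (a b : A) :
    FinMat.mul (Finsupp.single (i, j) a) (Finsupp.single (l, k) b) =
      if j = l then Finsupp.single (i, k) (a * b) else 0 := by
  classical
  unfold FinMat.mul
  rw [Finsupp.sum_single_index, Finsupp.sum_single_index]
  · simp
  · simp

theorem FinMat.mul_add {I J K A : Type*} [Ring A] [DecidableEq J] (x : FinMat I J A)
    (y y' : FinMat J K A) : FinMat.mul x (y + y') = FinMat.mul x y + FinMat.mul x y' := by
  classical
  unfold FinMat.mul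
  rw [← Finsupp.sum_add]
  refine Finsupp.sum_congr fun p _ => ?_
  rw [Finsupp.sum_add_index']
  · simp
  · intro q b b'
    split_ifs <;> simp [_root_.mul_add]

theorem FinMat.add_mul {I J K A : Type*} [Ring A] [DecidableEq J] (x x' : FinMat I J A)
    (y : FinMat J K A) : FinMat.mul (x + x') y = FinMat.mul x y + FinMat.mul x' y := by
  classical
  unfold FinMat.mul
  rw [Finsupp.sum_add_index']
  · simp
  · intro q b b'
    rw [← Finsupp.sum_add]
    refine Finsupp.sum_congr fun p _ => ?_
    split_ifs <;> simp [_root_.add_mul]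

theorem FinMat.mul_zero {I J K A : Type*} [Ring A] [DecidableEq J] (x : FinMat I J A) :
    FinMat.mul x (0 : FinMat J K A) = 0 := by
  simp [FinMat.mul]

theorem FinMat.zero_mul {I J K A : Type*} [Ring A] [DecidableEq J] (y : FinMat J K A) :
    FinMat.mul (0 : FinMat I J A) y = 0 := by
  simp [FinMat.mul]

/-- The entries of a product are given by the usual formula. -/
theorem FinMat.mul_apply {I J K A : Type*} [Ring A] [DecidableEq J] (x : FinMat I J A)
    (y : FinMat J K A) (i : I) (k : K) :
    FinMat.mul x y (i, k) = ∑ᶠ j, x (i, j) * y (j, k) := by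
  classical
  have hx : ∀ x : FinMat I J A, (Function.support fun j => x (i, j) * y (j, k)).Finite := by
    intro x
    refine (x.support.finite_toSet.image Prod.snd).subset fun j hj => ?_
    refine ⟨(i, j), ?_, rfl⟩
    simp only [Finset.mem_coe, Finsupp.mem_support_iff]
    intro h
    simp [h] at hj
  induction x using Finsupp.induction_linear with
  | zero => simp [FinMat.zero_mul]
  | add x x' ih ih' =>
    simp only [FinMat.add_mul, Finsupp.add_apply, ih, ih', _root_.add_mul]
    rw [finsum_add_distrib (hx x) (hx x')]
  | single p a =>
    obtain ⟨i', j'⟩ := p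
    rw [finsum_eq_single _ j']
    · induction y using Finsupp.induction_linear with
      | zero => simp [FinMat.mul_zero]
      | add y y' ih ih' =>
        have aux : ∀ y : FinMat J K A, ∀ x : FinMat I J A,
            (Function.support fun j => x (i, j) * y (j, k)).Finite := by
          intro y x
          refine (x.support.finite_toSet.image Prod.snd).subset fun j hj => ?_
          refine ⟨(i, j), ?_, rfl⟩
          simp only [Finset.mem_coe, Finsupp.mem_support_iff]
          intro h
          simp [h] at hj
        simp only [FinMat.mul_add, Finsupp.add_apply, ih (aux y), ih' (aux y'), _root_.mul_add]
      | single q b =>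
        obtain ⟨j'', k''⟩ := q
        rw [FinMat.mul_single]
        split_ifs with h
        · subst h
          simp only [Finsupp.single_apply, Prod.mk.injEq]
          by_cases h1 : i' = i <;> by_cases h2 : k'' = k <;> simp [h1, h2]
        · have : (j'', k'') ≠ (j', k) := by
            intro h'
            exact h (congrArg Prod.fst h').symm
          simp [Finsupp.single_apply, this]
    · intro j hj
      have : (i', j') ≠ (i, j) := by
        intro h'
        exact hj (congrArg Prod.snd h').symm
      simp [this]

/-! ### The elementary linear group

`ι` is the set of matrix indices (`N` in the theorem). -/

section Elementary

variable (ι : Type v) [DecidableEq ι] (A : Type u) [Ring A]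

/-- Square matrices which differ from an integral multiple of the identity matrix in only finitely
many entries, i.e. the elements of `ℤ 1 + Mat_ι(A)`. -/
def IsExMat (x : Matrix ι ι A) : Prop :=
  ∃ c : ℤ, {p : ι × ι | (x - c • (1 : Matrix ι ι A)) p.1 p.2 ≠ 0}.Finite

/-- The unital ring `Mat_ι(A)_ex = ℤ 1 + Mat_ι(A)`, of which only the multiplicative structure is
needed here. It consists of all matrices if `ι` is finite. -/
def ExMat : Type (max u v) := {x : Matrix ι ι A // IsExMat ι A x}

variable {ι A}

theorem isExMat_iff (x : Matrix ι ι A) : IsExMat ι A x ↔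
    ∃ c : ℤ, ∃ S : Finset ι, ∀ i j, (i ∉ S ∨ j ∉ S) → x i j = if i = j then (c : A) else 0 := by
  have key : ∀ (c : ℤ) (i j : ι), (c • (1 : Matrix ι ι A)) i j = if i = j then (c : A) else 0 := by
    intro c i j
    rw [Matrix.smul_apply, Matrix.one_apply]
    split_ifs <;> simp
  constructor
  · rintro ⟨c, hc⟩
    refine ⟨c, hc.toFinset.image Prod.fst ∪ hc.toFinset.image Prod.snd, fun i j hij => ?_⟩
    by_contra hne
    have hmem : (i, j) ∈ hc.toFinset := by
      rw [Set.Finite.mem_toFinset]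
      change (x - c • (1 : Matrix ι ι A)) i j ≠ 0
      rw [Matrix.sub_apply, key, sub_ne_zero]
      exact hne
    rcases hij with h | h
    · exact h (Finset.mem_union_left _ (Finset.mem_image.2 ⟨_, hmem, rfl⟩))
    · exact h (Finset.mem_union_right _ (Finset.mem_image.2 ⟨_, hmem, rfl⟩))
  · rintro ⟨c, S, h⟩
    refine ⟨c, (S ×ˢ S).finite_toSet.subset fun p hp => ?_⟩
    by_contra hn
    apply hp
    rw [Matrix.sub_apply, key, sub_eq_zero]
    apply h
    simp only [Finset.coe_product, Set.mem_prod, Finset.mem_coe] at hn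
    tauto

theorem IsExMat.finite_row {x : Matrix ι ι A} (hx : IsExMat ι A x) (i : ι) :
    {j | x i j ≠ 0}.Finite := by
  obtain ⟨c, S, h⟩ := (isExMat_iff x).1 hx
  refine (insert i S).finite_toSet.subset fun j hj => ?_
  by_contra hn
  simp only [Finset.coe_insert, Set.mem_insert_iff, Finset.mem_coe, not_or] at hn
  exact hj (by rw [h i j (Or.inr hn.2), if_neg (Ne.symm hn.1)])

theorem finsum_eq_sum_row {x : Matrix ι ι A} {i : ι} {T : Finset ι} (f : ι → A)
    (hT : ∀ j, j ∉ T → x i j = 0) : ∑ᶠ j, x i j * f j = ∑ j ∈ T, x i j * f j := by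
  refine finsum_eq_sum_of_support_subset _ fun j hj => ?_
  by_contra hn
  exact hj (by simp [hT j hn])

theorem IsExMat.mul {x y : Matrix ι ι A} (hx : IsExMat ι A x) (hy : IsExMat ι A y) :
    IsExMat ι A (Matrix.of fun i k => ∑ᶠ j, x i j * y j k) := by
  obtain ⟨c, S, h⟩ := (isExMat_iff x).1 hx
  obtain ⟨d, T, h'⟩ := (isExMat_iff y).1 hy
  refine (isExMat_iff _).2 ⟨c * d, S ∪ T, fun i k hik => ?_⟩
  rw [Matrix.of_apply]
  by_cases hi : i ∈ S
  · by_cases hk : k ∈ T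
    · exfalso
      simp only [Finset.mem_union] at hik
      tauto
    · rw [finsum_eq_single _ k]
      · rw [h' k k (Or.inl hk), if_pos rfl]
        by_cases hkS : k ∈ S
        · have hne : i ≠ k := by
            rintro rfl
            simp only [Finset.mem_union] at hik
            tauto
          have hiT : i ∉ S ∪ T ∨ k ∉ S ∪ T := hik
          simp only [Finset.mem_union] at hiT
          tauto
        · rw [h i k (Or.inr hkS)]
          split_ifs <;> simp
      · intro j hj
        rw [h' j k (Or.inr hk), if_neg hj, MulZeroClass.mul_zero]
  · rw [finsum_eq_single _ i]
    · rw [h i i (Or.inl hi), if_pos rfl]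
      by_cases hiT : i ∈ T
      · have hk : k ∉ T := by
          simp only [Finset.mem_union] at hik
          tauto
        rw [h' i k (Or.inr hk)]
        split_ifs <;> simp
      · rw [h' i k (Or.inl hiT)]
        split_ifs <;> simp
    · intro j hj
      rw [h i j (Or.inl hi), if_neg (Ne.symm hj), MulZeroClass.zero_mul]

theorem isExMat_one : IsExMat ι A 1 := ⟨1, by simp⟩

/-- The usual matrix multiplication. -/
instance : Mul (ExMat ι A) := ⟨fun x y => ⟨_, x.2.mul y.2⟩⟩

instance : One (ExMat ι A) := ⟨⟨1, isExMat_one⟩⟩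

theorem ExMat.mul_apply (x y : ExMat ι A) (i k : ι) :
    (x * y).1 i k = ∑ᶠ j, x.1 i j * y.1 j k := rfl

theorem ExMat.one_val : (1 : ExMat ι A).1 = 1 := rfl

theorem ExMat.ext {x y : ExMat ι A} (h : ∀ i j, x.1 i j = y.1 i j) : x = y :=
  Subtype.ext (Matrix.ext h)

instance : Monoid (ExMat ι A) where
  mul_assoc x y z := by
    classical
    refine ExMat.ext fun i l => ?_
    have hx : ∀ j, j ∉ (x.2.finite_row i).toFinset → x.1 i j = 0 := by
      intro j hj
      simpa using hj
    set T := (x.2.finite_row i).toFinset with hT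
    set U := T.biUnion fun j => (y.2.finite_row j).toFinset with hU
    have hy : ∀ j ∈ T, ∀ k, k ∉ U → y.1 j k = 0 := by
      intro j hj k hk
      by_contra hne
      exact hk (Finset.mem_biUnion.2 ⟨j, hj, by simpa using hne⟩)
    have hxy : ∀ k, (x * y).1 i k = ∑ j ∈ T, x.1 i j * y.1 j k := fun k => by
      rw [ExMat.mul_apply, finsum_eq_sum_row _ hx]
    have hxy0 : ∀ k, k ∉ U → (x * y).1 i k = 0 := fun k hk => by
      rw [hxy]
      refine Finset.sum_eq_zero fun j hj => ?_
      rw [hy j hj k hk, MulZeroClass.mul_zero]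
    rw [ExMat.mul_apply, finsum_eq_sum_row _ hxy0, ExMat.mul_apply, finsum_eq_sum_row _ hx]
    have : ∀ j ∈ T, x.1 i j * (y * z).1 j l = ∑ k ∈ U, x.1 i j * (y.1 j k * z.1 k l) := by
      intro j hj
      rw [ExMat.mul_apply, finsum_eq_sum_row _ (hy j hj), Finset.mul_sum]
    rw [Finset.sum_congr rfl this, Finset.sum_comm]
    refine Finset.sum_congr rfl fun k _ => ?_
    rw [hxy, Finset.sum_mul]
    exact Finset.sum_congr rfl fun j _ => mul_assoc _ _ _
  one_mul x := by
    refine ExMat.ext fun i k => ?_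
    rw [ExMat.mul_apply, finsum_eq_single _ i]
    · simp [ExMat.one_val]
    · intro j hj
      simp [ExMat.one_val, Matrix.one_apply_ne (Ne.symm hj)]
  mul_one x := by
    refine ExMat.ext fun i k => ?_
    rw [ExMat.mul_apply, finsum_eq_single _ k]
    · simp [ExMat.one_val]
    · intro j hj
      simp [ExMat.one_val, Matrix.one_apply_ne hj]

theorem isExMat_elem (i j : ι) (a : A) : IsExMat ι A (1 + Matrix.single i j a) := by
  refine ⟨1, (Set.finite_singleton (i, j)).subset fun p hp => ?_⟩
  by_contra hn
  apply hp
  have hn' : ¬ (i = p.1 ∧ j = p.2) := by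
    rintro ⟨h1, h2⟩
    exact hn (Prod.ext h1.symm h2.symm)
  simp [hn']

/-- The matrix `1 + a E_{ij}`. -/
def elemMat (i j : ι) (a : A) : ExMat ι A := ⟨1 + Matrix.single i j a, isExMat_elem i j a⟩

theorem elemMat_mul_apply (i j : ι) (a : A) (x : ExMat ι A) (p q : ι) :
    (elemMat i j a * x).1 p q = x.1 p q + if i = p then a * x.1 j q else 0 := by
  have h0 : ∀ m, m ∉ ({p, j} : Finset ι) → (elemMat i j a).1 p m = 0 := by
    intro m hm
    simp only [Finset.mem_insert, Finset.mem_singleton, not_or] at hm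
    change (1 + Matrix.single i j a) p m = 0
    rw [Matrix.add_apply, Matrix.one_apply_ne (Ne.symm hm.1), Matrix.single_apply, if_neg, zero_add]
    exact fun h => hm.2 h.2.symm
  rw [ExMat.mul_apply, finsum_eq_sum_row _ h0]
  change ∑ m ∈ ({p, j} : Finset ι), (1 + Matrix.single i j a) p m * x.1 m q = _
  by_cases hpj : p = j
  · subst hpj
    simp only [Finset.pair_eq_singleton, Finset.sum_singleton, Matrix.add_apply, Matrix.one_apply_eq,
      Matrix.single_apply, _root_.add_mul, _root_.one_mul]
    split_ifs <;> simp_all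
  · rw [Finset.sum_pair hpj]
    simp only [Matrix.add_apply, Matrix.one_apply_eq, Matrix.one_apply_ne hpj,
      Matrix.single_apply, _root_.add_mul, _root_.one_mul, zero_add]
    have : ¬ (j = p) := fun h => hpj h.symm
    simp [this]

theorem elemMat_mul (i j : ι) (h : i ≠ j) (a b : A) :
    elemMat i j a * elemMat i j b = elemMat i j (a + b) := by
  refine ExMat.ext fun p q => ?_
  rw [elemMat_mul_apply]
  change (1 + Matrix.single i j b) p q + (if i = p then a * (1 + Matrix.single i j b) j q else 0) =
    (1 + Matrix.single i j (a + b)) p q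
  simp only [Matrix.add_apply, Matrix.single_apply, Matrix.one_apply]
  by_cases h1 : i = p
  · subst h1
    by_cases h2 : j = q
    · subst h2
      simp [h, add_comm]
    · simp [h2]
  · simp [h1]

theorem elemMat_zero (i j : ι) : elemMat i j (0 : A) = 1 := by
  refine ExMat.ext fun p q => ?_
  change (1 + Matrix.single i j (0 : A)) p q = (1 : Matrix ι ι A) p q
  simp

/-- The elementary matrix `e_{ij}(a) = 1 + a E_{ij}`, `i ≠ j`, as an invertible matrix. -/
def elem (i j : ι) (h : i ≠ j) (a : A) : (ExMat ι A)ˣ where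
  val := elemMat i j a
  inv := elemMat i j (-a)
  val_inv := by rw [elemMat_mul i j h, add_neg_cancel, elemMat_zero]
  inv_val := by rw [elemMat_mul i j h, neg_add_cancel, elemMat_zero]

variable (ι A) in
/-- The elementary linear group `EL_ι(A)`, generated by all `e_{ij}(a)`. -/
def EL : Subgroup (ExMat ι A)ˣ :=
  Subgroup.closure {g | ∃ (i j : ι) (h : i ≠ j) (a : A), g = elem i j h a}

end Elementary

/-! ### The linear Steinberg group -/

section Linear

variable (ι : Type v) (A : Type u) [Ring A]

/-- The generating symbols `x_{ij}(a)` with `i ≠ j`. -/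
abbrev LinGen : Type (max u v) := {p : ι × ι // p.1 ≠ p.2} × A

variable {ι A}

/-- The generator `x_{ij}(a)` of the free group. -/
def genLin (i j : ι) (h : i ≠ j) (a : A) : FreeGroup (LinGen ι A) :=
  FreeGroup.of (⟨(i, j), h⟩, a)

/-- The relators of the linear Steinberg group. -/
inductive LinRel : FreeGroup (LinGen ι A) → Prop
  | e1 (i j : ι) (h : i ≠ j) (a b : A) :
      LinRel (genLin i j h a * genLin i j h b * (genLin i j h (a + b))⁻¹)
  | e2 (i j k l : ι) (hij : i ≠ j) (hkl : k ≠ l) (hjk : j ≠ k) (hli : l ≠ i) (a b : A) :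
      LinRel ⁅genLin i j hij a, genLin k l hkl b⁆
  | e3 (i j l : ι) (hij : i ≠ j) (hjl : j ≠ l) (hil : i ≠ l) (a b : A) :
      LinRel (⁅genLin i j hij a, genLin j l hjl b⁆ * (genLin i l hil (a * b))⁻¹)

variable (ι A) in
/-- The linear Steinberg group `St_ι(A)`. -/
abbrev LinSt : Type (max u v) := PresentedGroup {r : FreeGroup (LinGen ι A) | LinRel r}

/-- The generator `x_{ij}(a)` of the linear Steinberg group. -/
def xLin (i j : ι) (h : i ≠ j) (a : A) : LinSt ι A := PresentedGroup.of (⟨(i, j), h⟩, a)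

theorem xLin_mul (i j : ι) (h : i ≠ j) (a b : A) :
    xLin i j h a * xLin i j h b = xLin i j h (a + b) :=
  mul_inv_eq_one.1 (PresentedGroup.one_of_mem (LinRel.e1 i j h a b))

theorem xLin_comm (i j k l : ι) (hij : i ≠ j) (hkl : k ≠ l) (hjk : j ≠ k) (hli : l ≠ i) (a b : A) :
    ⁅xLin i j hij a, xLin k l hkl b⁆ = 1 :=
  PresentedGroup.one_of_mem (LinRel.e2 i j k l hij hkl hjk hli a b)

theorem xLin_comm' (i j l : ι) (hij : i ≠ j) (hjl : j ≠ l) (hil : i ≠ l) (a b : A) :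
    ⁅xLin i j hij a, xLin j l hjl b⁆ = xLin i l hil (a * b) :=
  mul_inv_eq_one.1 (PresentedGroup.one_of_mem (LinRel.e3 i j l hij hjl hil a b))

/-- `x_{ij}` as a homomorphism from the additive group of `A`. -/
def xLinHom (i j : ι) (h : i ≠ j) : Multiplicative A →* LinSt ι A :=
  MonoidHom.mk' (fun a => xLin i j h a.toAdd) fun _ _ => (xLin_mul i j h _ _).symm

theorem xLin_zero (i j : ι) (h : i ≠ j) : xLin i j h (0 : A) = 1 :=
  map_one (xLinHom i j h)

theorem xLin_neg (i j : ι) (h : i ≠ j) (a : A) : xLin i j h (-a) = (xLin i j h a)⁻¹ :=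
  map_inv (xLinHom i j h) (Multiplicative.ofAdd a)

theorem xLin_comm'' (i j k : ι) (hij : i ≠ j) (hki : k ≠ i) (hkj : k ≠ j) (a b : A) :
    ⁅xLin i j hij a, xLin k i hki b⁆ = xLin k j hkj (-(b * a)) := by
  rw [← commutatorElement_inv, xLin_comm' k i j hki hij hkj, xLin_neg]

variable [DecidableEq ι]

theorem elem_rel : ∀ r ∈ {r : FreeGroup (LinGen ι A) | LinRel r},
    FreeGroup.lift (fun g : LinGen ι A => elem g.1.1.1 g.1.1.2 g.1.2 g.2) r = 1 := by
  intro r hr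
  cases hr with
  | e1 i j h a b =>
    simp only [genLin, map_mul, map_inv, FreeGroup.lift_apply_of]
    rw [mul_inv_eq_one]
    exact Units.ext (elemMat_mul i j h a b)
  | e2 i j k l hij hkl hjk hli a b =>
    simp only [genLin, map_commutatorElement, FreeGroup.lift_apply_of]
    rw [commutatorElement_eq_one_iff_mul_comm]
    refine Units.ext (ExMat.ext fun p q => ?_)
    change (elemMat i j a * elemMat k l b).1 p q = (elemMat k l b * elemMat i j a).1 p q
    rw [elemMat_mul_apply, elemMat_mul_apply]
    change (1 + Matrix.single k l b) p q + (if i = p then a * (1 + Matrix.single k l b) j q else 0) =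
      (1 + Matrix.single i j a) p q + (if k = p then b * (1 + Matrix.single i j a) l q else 0)
    simp only [Matrix.add_apply, Matrix.single_apply, Matrix.one_apply, hjk.symm, hli.symm,
      false_and, if_false, add_zero]
    by_cases h1 : i = p <;> by_cases h2 : k = p <;> by_cases h3 : j = q <;> by_cases h4 : l = q <;>
      simp [h1, h2, h3, h4, add_comm, add_left_comm]
  | e3 i j l hij hjl hil a b =>
    simp only [genLin, map_mul, map_inv, map_commutatorElement, FreeGroup.lift_apply_of]
    rw [mul_inv_eq_one, commutatorElement_def, mul_inv_eq_iff_eq_mul, mul_inv_eq_iff_eq_mul]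
    refine Units.ext (ExMat.ext fun p q => ?_)
    change (elemMat i j a * elemMat j l b).1 p q =
      (elemMat i l (a * b) * elemMat j l b * elemMat i j a).1 p q
    rw [mul_assoc, elemMat_mul_apply, elemMat_mul_apply, elemMat_mul_apply, elemMat_mul_apply]
    change (1 + Matrix.single j l b) p q + (if i = p then a * (1 + Matrix.single j l b) j q else 0) =
      (1 + Matrix.single i j a) p q + (if j = p then b * (1 + Matrix.single i j a) l q else 0) +
      (if i = p then a * b * ((1 + Matrix.single i j a) l q +
        (if j = l then b * (1 + Matrix.single i j a) l q else 0)) else 0)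
    simp only [Matrix.add_apply, Matrix.single_apply, Matrix.one_apply, hjl, hil,
      false_and, true_and, if_false, add_zero]
    by_cases h1 : i = p
    · subst h1
      by_cases h3 : j = q
      · have h4 : l ≠ q := fun h4 => hjl (h3.trans h4.symm)
        simp [h3, h4]
      · by_cases h4 : l = q <;> simp [h3, h4, add_assoc]
    · by_cases h2 : j = p <;> by_cases h4 : l = q <;> simp [h1, h2, h4]

theorem elem_mem (i j : ι) (h : i ≠ j) (a : A) : elem i j h a ∈ EL ι A :=
  Subgroup.subset_closure ⟨i, j, h, a, rfl⟩

variable (ι A) in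
/-- The homomorphism `℘ : St_ι(A) → EL_ι(A)`, `x_{ij}(a) ↦ e_{ij}(a)`. -/
def wp : LinSt ι A →* EL ι A :=
  PresentedGroup.toGroup (f := fun g : LinGen ι A =>
      (⟨elem g.1.1.1 g.1.1.2 g.1.2 g.2, elem_mem _ _ _ _⟩ : EL ι A)) (by
    intro r hr
    apply Subtype.ext
    refine Eq.trans ?_ (elem_rel r hr)
    change ((EL ι A).subtype.comp (FreeGroup.lift _)) r = _
    congr 1
    ext g
    simp)

theorem wp_xLin (i j : ι) (h : i ≠ j) (a : A) :
    wp ι A (xLin i j h a) = ⟨elem i j h a, elem_mem i j h a⟩ :=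
  PresentedGroup.toGroup.of _

end Linear

/-! ### The Jordan-style Steinberg group

`I` is a set of indices and `J = Iᶜ`. -/

section Jordan

variable {ι : Type v} (I : Set ι) (A : Type u) [Ring A]

/-- `V⁺ = Mat_{IJ}(A)`. -/
abbrev VPlus : Type (max u v) := FinMat I (Iᶜ : Set ι) A

/-- `V⁻ = Mat_{JI}(A)`. -/
abbrev VMinus : Type (max u v) := FinMat (Iᶜ : Set ι) I A

variable {I}

/-- The root `ε_i - ε_j` in `R_1`, `(i, j) ∈ I × J`, in the space `⊕ ℝ ε_i`. -/
def root (i : I) (j : (Iᶜ : Set ι)) : ι →₀ ℝ :=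
  Finsupp.single (i : ι) 1 - Finsupp.single (j : ι) 1

/-- The inner product on `⊕ ℝ ε_i` with orthonormal basis `(ε_i)`. -/
def rootInner (α β : ι →₀ ℝ) : ℝ := α.sum fun i c => c * β i

variable (I)

/-- The generating symbols `x_+(u)`, `u ∈ V⁺`, and `x_-(v)`, `v ∈ V⁻`. -/
abbrev JordanGen : Type (max u v) := VPlus I A ⊕ VMinus I A

variable {I A}

/-- The generator `x_+(u)` of the free group. -/
def genPlus (u : VPlus I A) : FreeGroup (JordanGen I A) := FreeGroup.of (Sum.inl u)

/-- The generator `x_-(v)` of the free group. -/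
def genMinus (v : VMinus I A) : FreeGroup (JordanGen I A) := FreeGroup.of (Sum.inr v)

variable [DecidableEq ι]

/-- The relators of the Jordan-style Steinberg group. For a root `α = ε_i - ε_j` in `R_1`, the
elements of `V_α⁺` and `V_α⁻` are `a E_{ij}` and `a E_{ji}` respectively. The symbol `α ⊥ β` means
`(α|β) = 0`, and `α — β` means `(α|β) = 1`. -/
inductive JordanRel : FreeGroup (JordanGen I A) → Prop
  | ej1_plus (u u' : VPlus I A) :
      JordanRel (genPlus (u + u') * (genPlus u * genPlus u')⁻¹)
  | ej1_minus (v v' : VMinus I A) :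
      JordanRel (genMinus (v + v') * (genMinus v * genMinus v')⁻¹)
  | ej2 (i k : I) (j l : (Iᶜ : Set ι)) (h : rootInner (root i j) (root k l) = 0) (a b : A) :
      JordanRel ⁅genPlus (Finsupp.single (i, j) a), genMinus (Finsupp.single (l, k) b)⁆
  | ej3_plus (i k : I) (j l : (Iᶜ : Set ι)) (h : rootInner (root i j) (root k l) = 1) (a b : A)
      (z : VPlus I A) :
      JordanRel (⁅⁅genPlus (Finsupp.single (i, j) a), genMinus (Finsupp.single (l, k) b)⁆,
        genPlus z⁆ *
        (genPlus (-FinMat.triple (Finsupp.single (i, j) a) (Finsupp.single (l, k) b) z))⁻¹)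
  | ej3_minus (i k : I) (j l : (Iᶜ : Set ι)) (h : rootInner (root i j) (root k l) = 1) (a b : A)
      (z : VMinus I A) :
      JordanRel (⁅⁅genMinus (Finsupp.single (j, i) a), genPlus (Finsupp.single (k, l) b)⁆,
        genMinus z⁆ *
        (genMinus (-FinMat.triple (Finsupp.single (j, i) a) (Finsupp.single (k, l) b) z))⁻¹)

variable (I A) in
/-- The Jordan-style Steinberg group `St(M_{IJ}(A), R)` with `J = Iᶜ`. -/
abbrev JordanSt : Type (max u v) := PresentedGroup {r : FreeGroup (JordanGen I A) | JordanRel r}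

/-- The generator `x_+(u)` of the Jordan-style Steinberg group. -/
def xPlus (u : VPlus I A) : JordanSt I A := PresentedGroup.of (Sum.inl u)

/-- The generator `x_-(v)` of the Jordan-style Steinberg group. -/
def xMinus (v : VMinus I A) : JordanSt I A := PresentedGroup.of (Sum.inr v)

end Jordan

/-! ### The canonical homomorphism `Φ` -/

section Phi

theorem suppProd_comm {κ A G : Type*} [Zero A] [Group G] (f : κ → A → G)
    (hc : ∀ p q a b, Commute (f p a) (f q b)) (u : κ →₀ A) (s : Set κ) :
    s.Pairwise (Function.onFun Commute fun p => f p (u p)) :=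
  fun p _ q _ _ => hc p q _ _

/-- The product of the pairwise commuting elements `f p (u p)` over the support of `u`. -/
def suppProd {κ A G : Type*} [Zero A] [Group G] (f : κ → A → G)
    (hc : ∀ p q a b, Commute (f p a) (f q b)) (u : κ →₀ A) : G :=
  u.support.noncommProd (fun p => f p (u p)) (suppProd_comm f hc u _)

theorem suppProd_eq {κ A G : Type*} [Zero A] [Group G] (f : κ → A → G)
    (hc : ∀ p q a b, Commute (f p a) (f q b)) (h0 : ∀ p, f p 0 = 1) (u : κ →₀ A)
    (s : Finset κ) (hs : u.support ⊆ s) :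
    suppProd f hc u = s.noncommProd (fun p => f p (u p)) (suppProd_comm f hc u _) := by
  classical
  have h3 : ∀ (t : Finset κ), t = u.support ∪ (s \ u.support) →
      t.noncommProd (fun p => f p (u p)) (suppProd_comm f hc u _) = suppProd f hc u := by
    rintro t rfl
    rw [Finset.noncommProd_union_of_disjoint Finset.disjoint_sdiff]
    rw [Finset.noncommProd_eq_pow_card (s \ u.support) _ _ 1]
    · simp [suppProd]
    · intro q hq
      have : u q = 0 := by simpa using (Finset.mem_sdiff.1 hq).2
      simp [this, h0]
  exact (h3 s (Finset.union_sdiff_of_subset hs).symm).symm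

theorem suppProd_add {κ A G : Type*} [AddGroup A] [Group G] (f : κ → A → G)
    (hc : ∀ p q a b, Commute (f p a) (f q b)) (hadd : ∀ p a b, f p (a + b) = f p a * f p b)
    (u u' : κ →₀ A) : suppProd f hc (u + u') = suppProd f hc u * suppProd f hc u' := by
  classical
  have h0 : ∀ p, f p 0 = 1 := fun p => by
    have := hadd p 0 0
    rw [add_zero] at this
    exact (mul_eq_left.1 this.symm)
  rw [suppProd_eq f hc h0 (u + u') (u.support ∪ u'.support) Finsupp.support_add,
    suppProd_eq f hc h0 u (u.support ∪ u'.support) Finset.subset_union_left,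
    suppProd_eq f hc h0 u' (u.support ∪ u'.support) Finset.subset_union_right,
    ← Finset.noncommProd_mul_distrib (fun p => f p (u p)) (fun p => f p (u' p))
      (suppProd_comm f hc u _) (suppProd_comm f hc u' _) fun p _ q _ _ => hc _ _ _ _]
  exact Finset.noncommProd_congr rfl (fun p _ => by simp [hadd]) _

theorem suppProd_single {κ A G : Type*} [Zero A] [Group G] (f : κ → A → G)
    (hc : ∀ p q a b, Commute (f p a) (f q b)) (h0 : ∀ p, f p 0 = 1) (p : κ) (a : A) :
    suppProd f hc (Finsupp.single p a) = f p a := by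
  classical
  rw [suppProd_eq f hc h0 _ {p} Finsupp.support_single_subset, Finset.noncommProd_singleton]
  simp

variable {ι : Type v} {I : Set ι} {A : Type u} [Ring A]

theorem ne_of_mem (i : I) (j : (Iᶜ : Set ι)) : (i : ι) ≠ (j : ι) :=
  fun h => j.2 (h ▸ i.2)

/-- The element `x'_+(u) = ∏ x_{ij}(u_{ij})` of the linear Steinberg group; the factors commute. -/
def xPlus' (u : VPlus I A) : LinSt ι A :=
  suppProd (fun p a => xLin (p.1 : ι) (p.2 : ι) (ne_of_mem p.1 p.2) a)
    (fun p q _ _ => commutatorElement_eq_one_iff_commute.1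
      (xLin_comm _ _ _ _ _ _ (ne_of_mem q.1 p.2).symm (ne_of_mem p.1 q.2).symm _ _)) u

/-- The element `x'_-(v) = ∏ x_{ji}(-v_{ji})` of the linear Steinberg group; the factors commute. -/
def xMinus' (v : VMinus I A) : LinSt ι A :=
  suppProd (fun p a => xLin (p.1 : ι) (p.2 : ι) (ne_of_mem p.2 p.1).symm (-a))
    (fun p q _ _ => commutatorElement_eq_one_iff_commute.1
      (xLin_comm _ _ _ _ _ _ (ne_of_mem p.2 q.1) (ne_of_mem q.2 p.1) _ _)) v

theorem xPlus'_add (u u' : VPlus I A) : xPlus' (u + u') = xPlus' u * xPlus' u' :=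
  suppProd_add _ _ (fun _ _ _ => (xLin_mul _ _ _ _ _).symm) u u'

theorem xMinus'_add (v v' : VMinus I A) : xMinus' (v + v') = xMinus' v * xMinus' v' :=
  suppProd_add _ _ (fun _ _ _ => by rw [xLin_mul, neg_add]) v v'

theorem xPlus'_single (i : I) (j : (Iᶜ : Set ι)) (a : A) :
    xPlus' (Finsupp.single (i, j) a) = xLin (i : ι) (j : ι) (ne_of_mem i j) a :=
  suppProd_single _ _ (fun _ => xLin_zero _ _ _) _ _

theorem xMinus'_single (i : I) (j : (Iᶜ : Set ι)) (a : A) :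
    xMinus' (Finsupp.single (j, i) a) = xLin (j : ι) (i : ι) (ne_of_mem i j).symm (-a) :=
  suppProd_single _ _ (fun _ => by rw [neg_zero, xLin_zero]) _ _

theorem xPlus'_zero : xPlus' (0 : VPlus I A) = 1 := by
  have h := xPlus'_add (0 : VPlus I A) 0
  rw [add_zero] at h
  exact mul_eq_left.1 h.symm

theorem xMinus'_zero : xMinus' (0 : VMinus I A) = 1 := by
  have h := xMinus'_add (0 : VMinus I A) 0
  rw [add_zero] at h
  exact mul_eq_left.1 h.symm

theorem xPlus'_neg (u : VPlus I A) : xPlus' (-u) = (xPlus' u)⁻¹ := by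
  rw [eq_inv_iff_mul_eq_one, ← xPlus'_add, neg_add_cancel, xPlus'_zero]

theorem xMinus'_neg (v : VMinus I A) : xMinus' (-v) = (xMinus' v)⁻¹ := by
  rw [eq_inv_iff_mul_eq_one, ← xMinus'_add, neg_add_cancel, xMinus'_zero]

/-- If `⁅g, x(z)⁆ = x(T z)` holds for matrix units, it holds for all `z`. -/
theorem commutator_extend {κ G : Type*} [Group G] (x : (κ →₀ A) → G)
    (hadd : ∀ u u', x (u + u') = x u * x u') (T : (κ →₀ A) →+ (κ →₀ A)) (g : G)
    (hs : ∀ p c, ⁅g, x (Finsupp.single p c)⁆ = x (T (Finsupp.single p c))) (z : κ →₀ A) :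
    ⁅g, x z⁆ = x (T z) := by
  have h0 : x 0 = 1 := by
    have := hadd 0 0
    rw [add_zero] at this
    exact (mul_eq_left.1 this.symm)
  induction z using Finsupp.induction_linear with
  | zero => rw [map_zero, h0, commutatorElement_one_right]
  | single p c => exact hs p c
  | add u u' ih ih' =>
    have h1 : ⁅g, x u * x u'⁆ = ⁅g, x u⁆ * (x u * ⁅g, x u'⁆ * (x u)⁻¹) := by
      simp only [commutatorElement_def]
      group
    rw [map_add, hadd, hadd, h1, ih, ih', ← hadd u, add_comm u, hadd _ u, mul_inv_cancel_right]

variable [DecidableEq ι]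

theorem rootInner_root (i k : I) (j l : (Iᶜ : Set ι)) :
    rootInner (root i j) (root k l) = (if i = k then 1 else 0) + (if j = l then 1 else 0) := by
  classical
  have key : ∀ β : ι →₀ ℝ, rootInner (root i j) β = β i - β j := by
    intro β
    unfold rootInner root
    rw [Finsupp.sum_sub_index fun _ _ _ => sub_mul _ _ _]
    simp
  rw [key]
  have h1 : (l : ι) ≠ i := (ne_of_mem i l).symm
  have h2 : (k : ι) ≠ j := ne_of_mem k j
  simp only [root, Finsupp.sub_apply, Finsupp.single_apply, h1, h2, if_false, Subtype.ext_iff,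
    eq_comm (a := (k : ι)), eq_comm (a := (l : ι))]
  ring

theorem root_edge {i k : I} {j l : (Iᶜ : Set ι)} (h : rootInner (root i j) (root k l) = 1) :
    (i = k ∧ j ≠ l) ∨ (i ≠ k ∧ j = l) := by
  rw [rootInner_root] at h
  by_cases h1 : i = k <;> by_cases h2 : j = l <;> simp [h1, h2] at h ⊢

theorem root_perp {i k : I} {j l : (Iᶜ : Set ι)} (h : rootInner (root i j) (root k l) = 0) :
    i ≠ k ∧ j ≠ l := by
  rw [rootInner_root] at h
  by_cases h1 : i = k <;> by_cases h2 : j = l <;> simp [h1, h2] at h ⊢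

/-- `z ↦ -{u v z}` as an additive map. -/
def negTriple {I J : Type*} [DecidableEq I] [DecidableEq J] (u : FinMat I J A) (v : FinMat J I A) :
    FinMat I J A →+ FinMat I J A :=
  AddMonoidHom.mk' (fun z => -FinMat.triple u v z) fun z z' => by
    simp only [FinMat.triple, FinMat.mul_add, FinMat.add_mul]
    abel

theorem ej3_plus_holds (i k : I) (j l : (Iᶜ : Set ι)) (h : rootInner (root i j) (root k l) = 1)
    (a b : A) (z : VPlus I A) :
    ⁅⁅xPlus' (Finsupp.single (i, j) a), xMinus' (Finsupp.single (l, k) b)⁆, xPlus' z⁆ =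
      xPlus' (-FinMat.triple (Finsupp.single (i, j) a) (Finsupp.single (l, k) b) z) := by
  refine commutator_extend xPlus' xPlus'_add
    (negTriple (Finsupp.single (i, j) a) (Finsupp.single (l, k) b)) _ ?_ z
  rintro ⟨r, s⟩ c
  change _ = xPlus' (-FinMat.triple _ _ _)
  rw [xPlus'_single, xMinus'_single, xPlus'_single, FinMat.triple, FinMat.mul_single,
    FinMat.mul_single, xPlus'_neg]
  rcases root_edge h with ⟨rfl, hjl⟩ | ⟨hik, rfl⟩
  · have hlj : (l : ι) ≠ j := fun e => hjl (Subtype.ext e.symm)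
    rw [if_neg hjl, FinMat.zero_mul, zero_add, xLin_comm'' _ _ _ _ _ hlj]
    by_cases hs : s = l
    · subst hs
      rw [if_pos rfl, FinMat.mul_single, if_pos rfl, xPlus'_single,
        xLin_comm'' _ _ _ _ _ (ne_of_mem r j), ← xLin_neg]
      congr 1
      simp [mul_assoc]
    · rw [if_neg hs, FinMat.zero_mul, xPlus'_zero, inv_one]
      exact xLin_comm _ _ _ _ _ _ (ne_of_mem r j).symm (fun e => hs (Subtype.ext e)) _ _
  · have hik' : (i : ι) ≠ k := fun e => hik (Subtype.ext e)
    rw [if_pos rfl, xLin_comm' _ _ _ _ _ hik']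
    have hz : FinMat.mul (if s = j then Finsupp.single (r, k) (c * b) else 0)
        (Finsupp.single (i, j) a) = (0 : VPlus I A) := by
      split_ifs
      · rw [FinMat.mul_single, if_neg (Ne.symm hik)]
      · rw [FinMat.zero_mul]
    rw [hz, add_zero, FinMat.mul_single]
    by_cases hr : k = r
    · subst hr
      rw [if_pos rfl, xPlus'_single, xLin_comm' _ _ _ _ _ (ne_of_mem i s), ← xLin_neg]
      congr 1
      simp
    · rw [if_neg hr, xPlus'_zero, inv_one]
      exact xLin_comm _ _ _ _ _ _ (fun e => hr (Subtype.ext e)) (ne_of_mem i s).symm _ _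

theorem ej3_minus_holds (i k : I) (j l : (Iᶜ : Set ι)) (h : rootInner (root i j) (root k l) = 1)
    (a b : A) (z : VMinus I A) :
    ⁅⁅xMinus' (Finsupp.single (j, i) a), xPlus' (Finsupp.single (k, l) b)⁆, xMinus' z⁆ =
      xMinus' (-FinMat.triple (Finsupp.single (j, i) a) (Finsupp.single (k, l) b) z) := by
  refine commutator_extend xMinus' xMinus'_add
    (negTriple (Finsupp.single (j, i) a) (Finsupp.single (k, l) b)) _ ?_ z
  rintro ⟨s, r⟩ c
  change _ = xMinus' (-FinMat.triple _ _ _)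
  rw [xPlus'_single, xMinus'_single, xMinus'_single, FinMat.triple, FinMat.mul_single,
    FinMat.mul_single, xMinus'_neg]
  rcases root_edge h with ⟨rfl, hjl⟩ | ⟨hik, rfl⟩
  · have hjl' : (j : ι) ≠ l := fun e => hjl (Subtype.ext e)
    rw [if_pos rfl, xLin_comm' _ _ _ _ _ hjl']
    have hz : FinMat.mul (if r = i then Finsupp.single (s, l) (c * b) else 0)
        (Finsupp.single (j, i) a) = (0 : VMinus I A) := by
      split_ifs
      · rw [FinMat.mul_single, if_neg (Ne.symm hjl)]
      · rw [FinMat.zero_mul]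
    rw [hz, add_zero, FinMat.mul_single]
    by_cases hs : l = s
    · subst hs
      rw [if_pos rfl, xMinus'_single, xLin_comm' _ _ _ _ _ (ne_of_mem r j).symm, ← xLin_neg]
      congr 1
      simp
    · rw [if_neg hs, xMinus'_zero, inv_one]
      exact xLin_comm _ _ _ _ _ _ (fun e => hs (Subtype.ext e)) (ne_of_mem r j) _ _
  · have hki : (k : ι) ≠ i := fun e => hik (Subtype.ext e.symm)
    rw [if_neg hik, FinMat.zero_mul, zero_add, xLin_comm'' _ _ _ _ _ hki]
    by_cases hr : r = k
    · subst hr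
      rw [if_pos rfl, FinMat.mul_single, if_pos rfl, xMinus'_single,
        xLin_comm'' _ _ _ _ _ (ne_of_mem i s).symm, ← xLin_neg]
      congr 1
      simp [mul_assoc]
    · rw [if_neg hr, FinMat.zero_mul, xMinus'_zero, inv_one]
      exact xLin_comm _ _ _ _ _ _ (ne_of_mem i s) (fun e => hr (Subtype.ext e)) _ _

theorem jordan_rel_holds : ∀ r ∈ {r : FreeGroup (JordanGen I A) | JordanRel r},
    FreeGroup.lift (Sum.elim xPlus' xMinus' : JordanGen I A → LinSt ι A) r = 1 := by
  intro r hr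
  cases hr with
  | ej1_plus u u' =>
    simp only [genPlus, map_mul, map_inv, FreeGroup.lift_apply_of, Sum.elim_inl]
    rw [mul_inv_eq_one, xPlus'_add]
  | ej1_minus v v' =>
    simp only [genMinus, map_mul, map_inv, FreeGroup.lift_apply_of, Sum.elim_inr]
    rw [mul_inv_eq_one, xMinus'_add]
  | ej2 i k j l h a b =>
    simp only [genPlus, genMinus, map_commutatorElement, FreeGroup.lift_apply_of, Sum.elim_inl,
      Sum.elim_inr]
    rw [xPlus'_single, xMinus'_single]
    obtain ⟨h1, h2⟩ := root_perp h
    exact xLin_comm _ _ _ _ _ _ (fun e => h2 (Subtype.ext e)) (fun e => h1 (Subtype.ext e.symm)) _ _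
  | ej3_plus i k j l h a b z =>
    simp only [genPlus, genMinus, map_mul, map_inv, map_commutatorElement, FreeGroup.lift_apply_of,
      Sum.elim_inl, Sum.elim_inr]
    rw [mul_inv_eq_one, ej3_plus_holds i k j l h]
  | ej3_minus i k j l h a b z =>
    simp only [genPlus, genMinus, map_mul, map_inv, map_commutatorElement, FreeGroup.lift_apply_of,
      Sum.elim_inl, Sum.elim_inr]
    rw [mul_inv_eq_one, ej3_minus_holds i k j l h]

variable (I A)

/-- The canonical homomorphism `Φ : St(M_{IJ}(A), R) → St_ι(A)`, `x_±(u) ↦ x'_±(u)`. -/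
def Phi : JordanSt I A →* LinSt ι A := PresentedGroup.toGroup jordan_rel_holds

variable {I A}

theorem Phi_xPlus (u : VPlus I A) : Phi I A (xPlus u) = xPlus' u := PresentedGroup.toGroup.of _

theorem Phi_xMinus (v : VMinus I A) : Phi I A (xMinus v) = xMinus' v := PresentedGroup.toGroup.of _

variable (I A)

/-- The homomorphism `p = ℘ ∘ Φ : St(M_{IJ}(A), R) → EL_ι(A)`, which maps `x_+(a E_{ij})` to
`e_{ij}(a)` and `x_-(a E_{ji})` to `e_{ji}(-a)`. -/
def pHom : JordanSt I A →* EL ι A := (wp ι A).comp (Phi I A)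

variable {I A}

theorem pHom_xPlus (i : I) (j : (Iᶜ : Set ι)) (a : A) :
    (pHom I A (xPlus (Finsupp.single (i, j) a)) : (ExMat ι A)ˣ) =
      elem (i : ι) (j : ι) (ne_of_mem i j) a := by
  rw [pHom, MonoidHom.comp_apply, Phi_xPlus, xPlus'_single, wp_xLin]

theorem pHom_xMinus (i : I) (j : (Iᶜ : Set ι)) (a : A) :
    (pHom I A (xMinus (Finsupp.single (j, i) a)) : (ExMat ι A)ˣ) =
      elem (j : ι) (i : ι) (ne_of_mem i j).symm (-a) := by
  rw [pHom, MonoidHom.comp_apply, Phi_xMinus, xMinus'_single, wp_xLin]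

end Phi

end JordanSteinberg

end

noncomputable section

namespace JordanSteinberg

open scoped commutatorElement

/-! ### Commutator identities -/

section Commutators

variable {G : Type*} [Group G] {g x y z : G}

/-! The Jordan-style group only has root elements x_{ij}(a) for i and j on different sides of the
partition. To invert Φ one must produce x_{il}(c) for i and l on the same side. The only candidates
are the commutators [x_{ij}(a), x_{jl}(b)] through an index j on the other side, and the crux is
that such a commutator depends only on i, l and the product ab.

Dependence on ab alone (`IsCrossSystem.w_eq`) comes from the Weyl element
x_{ji}(1)x_{ij}(-1)x_{ji}(1): conjugating the commutator by it, once as a whole and once factor by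
factor, yields two expressions whose comparison is the claim. Independence of j
(`IsCrossSystem.w_indep`) comes from conjugating a commuting pair of root elements by an element
that plays the role of x_{jk}(1). The enlarged family then satisfies all Steinberg relations
(`IsCrossSystem.crossExt_comm`, `IsCrossSystem.crossExt_commutator`): a same-side element is written
as a commutator through a suitable index and conjugated factor by factor. This gives the inverse
homomorphism, hence `Phi_bijective`.

For central extensions, commutators in E depend only on the images of their entries. With at least
five indices, any four leave a fifth free. Lifts of commuting root elements therefore commute, and
the commutators of lifts form a Steinberg family in E (`IsSteinbergFamily.exists_lift`). The lift is
unique because every generator is a commutator.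

In infinite rank, an element g of the kernel of ℘ involves finitely many indices. For an unused
index n, g normalizes the row and column subgroups attached to n, on which ℘ is injective; so g
centralizes them. By surjectivity of Φ for the partition with J = {n}, they generate the whole
group, and g is central (`ker_wp_le_center`). -/

theorem commutator_mul_left (h : Commute x ⁅y, z⁆) : ⁅x * y, z⁆ = ⁅y, z⁆ * ⁅x, z⁆ := by
  have : ⁅x * y, z⁆ = x * ⁅y, z⁆ * x⁻¹ * ⁅x, z⁆ := by
    simp only [commutatorElement_def]; group
  rw [this, h.eq, mul_inv_cancel_right]

theorem commutator_mul_right (h : Commute y ⁅x, z⁆) : ⁅x, y * z⁆ = ⁅x, y⁆ * ⁅x, z⁆ := by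
  have : ⁅x, y * z⁆ = ⁅x, y⁆ * (y * ⁅x, z⁆ * y⁻¹) := by
    simp only [commutatorElement_def]; group
  rw [this, h.eq, mul_inv_cancel_right]

theorem conj_eq_commutator_mul (g x : G) : MulAut.conj g x = ⁅g, x⁆ * x := by
  simp [commutatorElement_def]

theorem conj_eq_of_commutator (h : ⁅g, x⁆ = z) : MulAut.conj g x = z * x := by
  rw [conj_eq_commutator_mul, h]

theorem conj_eq_of_commute (h : Commute g x) : MulAut.conj g x = x := by
  rw [MulAut.conj_apply, h.eq, mul_inv_cancel_right]

theorem commute_of_conj_eq (h : MulAut.conj g x = x) : Commute g x := by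
  rw [MulAut.conj_apply, mul_inv_eq_iff_eq_mul] at h
  exact h

theorem commutator_eq_of_conj (h : MulAut.conj g x = z * x) : ⁅g, x⁆ = z := by
  rw [conj_eq_commutator_mul] at h
  exact mul_right_cancel h

theorem conj_symm_of_commutator (h : ⁅g, x⁆ = z) (hz : Commute z g) :
    MulAut.conj x g = g * z⁻¹ := by
  subst h
  rw [← hz.inv_left.eq, commutatorElement_inv, conj_eq_commutator_mul]

theorem commutator_inv_right_of_commutator (h : ⁅g, x⁆ = z) (hz : Commute z g) :
    ⁅x, g⁻¹⁆ = z := by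
  subst h
  have : ⁅x, g⁻¹⁆ = g⁻¹ * (⁅g, x⁆ * g) := by
    simp only [commutatorElement_def]; group
  rw [this, hz.eq, inv_mul_cancel_left]

theorem commutator_inv_left_of_commutator (h : ⁅g, x⁆ = z)
    (hz : Commute g z) : ⁅g⁻¹, x⁆ = z⁻¹ := by
  subst h
  have : ⁅g⁻¹, x⁆ = g⁻¹ * ⁅g, x⁆⁻¹ * g := by
    simp only [commutatorElement_def]; group
  rw [this, hz.inv_inv.eq, inv_mul_cancel_right]

theorem commute_commutator (h1 : Commute g x) (h2 : Commute g y) : Commute g ⁅x, y⁆ := by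
  rw [commutatorElement_def]
  exact ((h1.mul_right h2).mul_right h1.inv_right).mul_right h2.inv_right

end Commutators

/-! ### Systems of root elements across a partition -/

/-- `i` and `j` lie on different sides of the partition `I ⊔ Iᶜ`. -/
def Cross {ι : Type*} (I : Set ι) (i j : ι) : Prop := i ∈ I ↔ j ∉ I

/-- A family `y_{ij}(a)`, for `i` and `j` on different sides, satisfying the Jordan-style
relations. -/
structure IsCrossSystem {ι A G : Type*} [Ring A] [Group G] (I : Set ι) (y : ι → ι → A → G) :
    Prop where
  add : ∀ {i j}, Cross I i j → ∀ a b, y i j (a + b) = y i j a * y i j b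
  comm : ∀ {i j k l}, Cross I i j → Cross I k l → j ≠ k → l ≠ i → ∀ a b,
    Commute (y i j a) (y k l b)
  -- These three fields are the triple-product relation on matrix units: the inner commutator acts
  -- on cross root elements as x_{il}(ab) would.
  comm_comm : ∀ {i j l r s}, Cross I i j → Cross I j l → i ≠ l → Cross I r s → r ≠ l → s ≠ i →
    ∀ a b c, Commute ⁅y i j a, y j l b⁆ (y r s c)
  comm_left : ∀ {i j l s}, Cross I i j → Cross I j l → i ≠ l → Cross I l s → ∀ a b c,
    ⁅⁅y i j a, y j l b⁆, y l s c⁆ = y i s (a * b * c)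
  comm_right : ∀ {i j l r}, Cross I i j → Cross I j l → i ≠ l → Cross I r i → ∀ a b c,
    ⁅⁅y i j a, y j l b⁆, y r i c⁆ = y r l (-(c * a * b))

section Cross

variable {ι : Type*} {I : Set ι}

theorem Cross.ne {i j : ι} (h : Cross I i j) : i ≠ j := by
  rintro rfl
  unfold Cross at h
  tauto

theorem Cross.symm {i j : ι} (h : Cross I i j) : Cross I j i := by
  unfold Cross at *
  tauto

theorem Cross.trans {i j k l : ι} (h : Cross I i j) (h' : Cross I j k) (h'' : Cross I k l) :
    Cross I i l := by
  unfold Cross at *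
  tauto

theorem Cross.trans_not {i j k : ι} (h : Cross I i j) (h' : ¬ Cross I j k) : Cross I i k := by
  unfold Cross at *
  tauto

theorem Cross.ne_of_cross {i j k : ι} (h : Cross I i j) (h' : Cross I j k) :
    ¬ Cross I i k := by
  unfold Cross at *
  tauto

theorem not_cross_symm {i j : ι} (h : ¬ Cross I i j) : ¬ Cross I j i := fun h' => h h'.symm

theorem Cross.of_not_left {i j k : ι} (h : ¬ Cross I i j) (h' : Cross I j k) : Cross I i k := by
  unfold Cross at *
  tauto

theorem exists_cross (hI : I.Nonempty) (hI' : I ≠ Set.univ) (i : ι) : ∃ j, Cross I i j := by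
  by_cases hi : i ∈ I
  · obtain ⟨j, hj⟩ := (Set.ne_univ_iff_exists_notMem I).1 hI'
    exact ⟨j, by simp [Cross, hi, hj]⟩
  · obtain ⟨j, hj⟩ := hI
    exact ⟨j, by simp [Cross, hi, hj]⟩

end Cross

namespace IsCrossSystem

variable {ι A G : Type*} [Ring A] [Group G] {I : Set ι} {y : ι → ι → A → G}

theorem zero (hy : IsCrossSystem I y) {i j : ι} (h : Cross I i j) : y i j 0 = 1 := by
  have := hy.add h 0 0
  rw [add_zero] at this
  exact mul_eq_left.1 this.symm

theorem neg (hy : IsCrossSystem I y) {i j : ι} (h : Cross I i j) (a : A) :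
    y i j (-a) = (y i j a)⁻¹ := by
  rw [eq_inv_iff_mul_eq_one, ← hy.add h, neg_add_cancel, hy.zero h]

/-- By `comm_comm` with (r, s) = (i, j), the commutator commutes with its own left entry, so the
correction term in the product formula disappears. -/
theorem w_add_left (hy : IsCrossSystem I y) {i j l : ι} (hij : Cross I i j) (hjl : Cross I j l)
    (hil : i ≠ l) (a a' b : A) :
    ⁅y i j (a + a'), y j l b⁆ = ⁅y i j a, y j l b⁆ * ⁅y i j a', y j l b⁆ := by
  rw [add_comm, hy.add hij, commutator_mul_left]
  exact (hy.comm_comm hij hjl hil hij hil hij.ne.symm _ _ _).symm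

theorem w_neg_left (hy : IsCrossSystem I y) {i j l : ι} (hij : Cross I i j) (hjl : Cross I j l)
    (hil : i ≠ l) (a b : A) : ⁅y i j (-a), y j l b⁆ = ⁅y i j a, y j l b⁆⁻¹ := by
  rw [eq_inv_iff_mul_eq_one, ← hy.w_add_left hij hjl hil, neg_add_cancel, hy.zero hij,
    commutatorElement_one_left]

/-! ### Weyl elements, and dependence of the commutator on the product only -/

section Weyl

variable {i j l : ι}

theorem conj_w (hy : IsCrossSystem I y) (hij : Cross I i j) (hjl : Cross I j l)
    (hil : i ≠ l) (a b c : A) :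
    MulAut.conj (y j i c) ⁅y i j a, y j l b⁆ = ⁅y i j a, y j l b⁆ * y j l (c * a * b) := by
  rw [conj_symm_of_commutator (hy.comm_right hij hjl hil hij.symm a b c), ← hy.neg hjl, neg_neg]
  exact (hy.comm_comm hij hjl hil hjl hjl.ne hil.symm _ _ _).symm

theorem conj_w' (hy : IsCrossSystem I y) (hij : Cross I i j) (hjl : Cross I j l)
    (hil : i ≠ l) (a b c : A) :
    MulAut.conj (y i j c) ⁅y l j a, y j i b⁆ = ⁅y l j a, y j i b⁆ * y l j (-(a * b * c)) := by
  rw [conj_symm_of_commutator (hy.comm_left hjl.symm hij.symm hil.symm hij a b c),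
    ← hy.neg hjl.symm]
  exact (hy.comm_comm hjl.symm hij.symm hil.symm hjl.symm hil.symm hjl.ne _ _ _).symm

/-- The element `x_{ji}(1) x_{ij}(-1) x_{ji}(1)`. -/
def weyl (y : ι → ι → A → G) (i j : ι) : G := y j i 1 * y i j (-1) * y j i 1

theorem conj_weyl (g : G) : MulAut.conj (weyl y i j) g =
    MulAut.conj (y j i 1) (MulAut.conj (y i j (-1)) (MulAut.conj (y j i 1) g)) := by
  simp [weyl, mul_assoc]

theorem conj_weyl_right (hy : IsCrossSystem I y) (hij : Cross I i j) (hjl : Cross I j l)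
    (hil : i ≠ l) (b : A) :
    MulAut.conj (weyl y i j) (y j l b) = ⁅y i j (-1), y j l b⁆ := by
  have h1 : MulAut.conj (y j i 1) (y j l b) = y j l b :=
    conj_eq_of_commute (hy.comm hij.symm hjl hij.ne hjl.ne.symm _ _)
  rw [conj_weyl, h1, conj_eq_commutator_mul (y i j (-1)), map_mul, h1, hy.conj_w hij hjl hil,
    mul_assoc, ← hy.add hjl]
  simp [hy.zero hjl]

theorem conj_weyl_left (hy : IsCrossSystem I y) (hij : Cross I i j) (hjl : Cross I j l)
    (hil : i ≠ l) :
    MulAut.conj (weyl y i j) (y l j 1) = ⁅y l j 1, y j i 1⁆⁻¹ := by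
  have h1 : MulAut.conj (y j i 1) (y l j 1) = ⁅y l j 1, y j i 1⁆⁻¹ * y l j 1 := by
    rw [conj_eq_commutator_mul, commutatorElement_inv]
  have h2 : Commute (y i j (-1)) (y l j 1) := hy.comm hij hjl.symm hjl.ne hij.ne.symm _ _
  have h3 : Commute ⁅y l j 1, y j i 1⁆ (y l j 1) :=
    hy.comm_comm hjl.symm hij.symm hil.symm hjl.symm hil.symm hjl.ne _ _ _
  have h4 : Commute ⁅y l j 1, y j i 1⁆ (y j i 1) :=
    hy.comm_comm hjl.symm hij.symm hil.symm hij.symm hij.ne.symm hil _ _ _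
  rw [conj_weyl, h1, map_mul, conj_eq_of_commute h2, map_inv, hy.conj_w' hij hjl hil]
  simp only [mul_neg, neg_neg, mul_one]
  rw [h3.eq, mul_inv_rev, inv_mul_cancel_right, map_inv, conj_eq_of_commute h4.symm]

/-- In the Steinberg group x_{il}(ab) is sent to x_{jl}(ab). Here the two commutators on the right
are not yet known to cancel; their product is the obstruction that `w_eq` removes. -/
theorem conj_weyl_w (hy : IsCrossSystem I y) (hij : Cross I i j) (hjl : Cross I j l)
    (hil : i ≠ l) (a b : A) :
    MulAut.conj (weyl y i j) ⁅y i j a, y j l b⁆ =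
      ⁅y i j a, y j l b⁆ * ⁅y i j (-1), y j l (a * b)⁆ * y j l (a * b) := by
  have h1 : ∀ c, MulAut.conj (y j i 1) (y j l c) = y j l c := fun c =>
    conj_eq_of_commute (hy.comm hij.symm hjl hij.ne hjl.ne.symm _ _)
  have h2 : MulAut.conj (y i j (-1)) ⁅y i j a, y j l b⁆ = ⁅y i j a, y j l b⁆ :=
    conj_eq_of_commute (hy.comm_comm hij hjl hil hij hil hij.ne.symm _ _ _).symm
  have h3 : Commute ⁅y i j (-1), y j l (a * b)⁆ (y j l (a * b)) :=
    hy.comm_comm hij hjl hil hjl hjl.ne hil.symm _ _ _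
  rw [conj_weyl, hy.conj_w hij hjl hil, map_mul, h2, conj_eq_commutator_mul (y i j (-1)), map_mul,
    map_mul, h1, hy.conj_w hij hjl hil, hy.conj_w hij hjl hil]
  simp only [one_mul, mul_neg, mul_one, neg_mul, hy.neg hjl, inv_mul_cancel_right]
  rw [mul_assoc _ (y j l (a * b)), ← h3.eq, ← mul_assoc]

/-- `[x_{ij}(a), x_{jl}(b)]` depends only on the product `ab`. -/
theorem w_eq (hy : IsCrossSystem I y) (hij : Cross I i j) (hjl : Cross I j l)
    (hil : i ≠ l) (a b : A) :
    ⁅y i j a, y j l b⁆ = ⁅y i j 1, y j l (a * b)⁆ := by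
  -- ζ would be x_{il}(a)x_{il}(-a), so it should be trivial. For the moment it suffices that its
  -- two factors act oppositely on the root elements needed below, so that ζ commutes with those.
  set ζ := ⁅y i j a, y j l 1⁆ * ⁅y i j (-1), y j l a⁆ with hζ
  set W := ⁅y l j 1, y j i 1⁆ with hW
  have hlj := hjl.symm
  have hji := hij.symm
  have h1 : MulAut.conj (weyl y i j) ⁅y i j a, y j l 1⁆ = ζ * y j l a := by
    rw [hy.conj_weyl_w hij hjl hil]
    simp [hζ]
  have h2 : Commute ζ (y l j 1) := by
    refine commute_of_conj_eq ?_
    rw [hζ, map_mul, MulAut.mul_apply, conj_eq_of_commutator (hy.comm_left hij hjl hil hlj _ _ _),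
      map_mul, conj_eq_of_commutator (hy.comm_left hij hjl hil hlj _ _ _),
      conj_eq_of_commute (hy.comm_comm hij hjl hil hij hil hij.ne.symm _ _ _)]
    simp [hy.neg hij]
  have h3 : ∀ c, Commute ζ (y j i c) := by
    intro c
    refine commute_of_conj_eq ?_
    rw [hζ, map_mul, MulAut.mul_apply, conj_eq_of_commutator (hy.comm_right hij hjl hil hji _ _ _),
      map_mul, conj_eq_of_commutator (hy.comm_right hij hjl hil hji _ _ _),
      conj_eq_of_commute (hy.comm_comm hij hjl hil hjl hjl.ne hil.symm _ _ _)]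
    simp [hy.neg hjl]
  have h4 : Commute ζ W := commute_commutator h2 (h3 1)
  have h5 : ⁅y j l a, W⁻¹⁆ = y j i (-a) := by
    refine commutator_inv_right_of_commutator ?_ ?_
    · rw [hW, hy.comm_right hlj hji hil.symm hjl]
      simp
    · exact (hy.comm_comm hlj hji hil.symm hji hij.ne.symm hil _ _ _).symm
  -- Recover y_{ij}(a) as a double commutator and conjugate its entries. The first entry becomes
  -- ζ·y_{jl}(a), and ζ drops out because it commutes with W and with `y j i`.
  have h6 : MulAut.conj (weyl y i j) (y i j a) = y j i (-a) := by
    have : y i j a = ⁅⁅y i j a, y j l 1⁆, y l j 1⁆ := by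
      rw [hy.comm_left hij hjl hil hlj]; simp
    rw [this, map_commutatorElement, h1, hy.conj_weyl_left hij hjl hil, commutator_mul_left, h5,
      h4.inv_right.commutator_eq, mul_one]
    rw [h5]
    exact h3 _
  -- Conjugating the two entries instead turns the left side into [y_{ji}(-a), [y_{ij}(-1),
  -- y_{jl}(b)]] = y_{jl}(ab), which cancels the last factor on the right and leaves the obstruction
  -- equal to 1.
  have h7 := hy.conj_weyl_w hij hjl hil a b
  rw [map_commutatorElement, h6, hy.conj_weyl_right hij hjl hil, ← commutatorElement_inv,
    hy.comm_right hij hjl hil hji, ← hy.neg hjl] at h7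
  simp only [mul_neg, mul_one, neg_neg] at h7
  rw [eq_comm, mul_eq_right, hy.w_neg_left hij hjl hil, mul_inv_eq_one] at h7
  exact h7

end Weyl

/-- The commuting elements y_{ij}(a) and y_{kl}(b) are conjugated by [y_{ji}(1), y_{ik}(1)], a
stand-in for x_{jk}(1). They become y_{ik}(-a)y_{ij}(a) and y_{jl}(b)y_{kl}(b), which must still
commute; in the expansion only the commutators through j and through k survive, and they are
mutually inverse. -/
theorem w_indep (hy : IsCrossSystem I y) {i j k l : ι} (hij : Cross I i j) (hjl : Cross I j l)
    (hik : Cross I i k) (hil : i ≠ l) (a b : A) :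
    ⁅y i j a, y j l b⁆ = ⁅y i k a, y k l b⁆ := by
  rcases eq_or_ne j k with rfl | hjk
  · rfl
  have hkl : Cross I k l := hik.symm.trans hij hjl
  have hc := (hy.comm hij hkl hjk hil.symm a b).map (MulAut.conj ⁅y j i 1, y i k 1⁆)
  rw [conj_eq_of_commutator (hy.comm_right hij.symm hik hjk hij _ _ _),
    conj_eq_of_commutator (hy.comm_left hij.symm hik hjk hkl _ _ _)] at hc
  simp only [mul_one, one_mul] at hc
  have h0 := hc.commutator_eq
  have e1 : ⁅y i j a, y j l b * y k l b⁆ = ⁅y i j a, y j l b⁆ := by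
    rw [commutator_mul_right, (hy.comm hij hkl hjk hil.symm a b).commutator_eq, mul_one]
    rw [(hy.comm hij hkl hjk hil.symm a b).commutator_eq]
    exact Commute.one_right _
  have e2 : ⁅y i k (-a), y j l b * y k l b⁆ = ⁅y i k a, y k l b⁆⁻¹ := by
    rw [commutator_mul_right, (hy.comm hik hjl hjk.symm hil.symm (-a) b).commutator_eq, one_mul,
      hy.w_neg_left hik hkl hil]
    exact (hy.comm_comm hik hkl hil hjl hjl.ne hil.symm _ _ _).symm
  rw [commutator_mul_left, e1, e2, mul_inv_eq_one] at h0
  · exact h0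
  · rw [e1]
    exact (hy.comm_comm hij hjl hil hik hil hik.ne.symm _ _ _).symm

end IsCrossSystem

/-! ### The Steinberg relations in a cross system -/

/-- The extension of a cross system to all pairs of indices; `o i` is an index on the other side
of `i`. -/
def crossExt {ι A G : Type*} [Ring A] [Group G] (I : Set ι) (y : ι → ι → A → G) (o : ι → ι)
    (i l : ι) (a : A) : G :=
  open Classical in if Cross I i l then y i l a else ⁅y i (o i) a, y (o i) l 1⁆

namespace IsCrossSystem

variable {ι : Type v} {A : Type u} {G : Type w} [Ring A] [Group G] {I : Set ι} {y : ι → ι → A → G}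
  {o : ι → ι}

theorem crossExt_of_cross {i l : ι} (h : Cross I i l) (a : A) :
    crossExt I y o i l a = y i l a := if_pos h

theorem commutator_eq_crossExt (hy : IsCrossSystem I y) (ho : ∀ i, Cross I i (o i)) {i j l : ι}
    (hij : Cross I i j) (hjl : Cross I j l) (hil : i ≠ l) (a b : A) :
    ⁅y i j a, y j l b⁆ = crossExt I y o i l (a * b) := by
  have hol : Cross I (o i) l := (ho i).symm.trans hij hjl
  rw [crossExt, if_neg (hij.ne_of_cross hjl), hy.w_indep hij hjl (ho i) hil,
    hy.w_eq (ho i) hol hil, hy.w_eq (ho i) hol hil (a * b), mul_one]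

theorem crossExt_eq_commutator (hy : IsCrossSystem I y) (ho : ∀ i, Cross I i (o i)) {i j l : ι}
    (hij : Cross I i j) (hjl : Cross I j l) (hil : i ≠ l) (a : A) :
    crossExt I y o i l a = ⁅y i j a, y j l 1⁆ := by
  rw [hy.commutator_eq_crossExt ho hij hjl hil, mul_one]

/-! ### Action of the same-side elements on cross root elements -/

section Same

variable {i l r s : ι}

theorem crossExt_commute (hy : IsCrossSystem I y) (ho : ∀ i, Cross I i (o i))
    (h : ¬ Cross I i l) (hil : i ≠ l) (hrs : Cross I r s) (hrl : r ≠ l) (hsi : s ≠ i) (a c : A) :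
    Commute (crossExt I y o i l a) (y r s c) := by
  have hol := (ho i).symm.trans_not h
  rw [hy.crossExt_eq_commutator ho (ho i) hol hil]
  exact hy.comm_comm (ho i) hol hil hrs hrl hsi _ _ _

theorem crossExt_left (hy : IsCrossSystem I y) (ho : ∀ i, Cross I i (o i))
    (h : ¬ Cross I i l) (hil : i ≠ l) (hls : Cross I l s) (a c : A) :
    ⁅crossExt I y o i l a, y l s c⁆ = y i s (a * c) := by
  have hol := (ho i).symm.trans_not h
  rw [hy.crossExt_eq_commutator ho (ho i) hol hil, hy.comm_left (ho i) hol hil hls, mul_one]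

theorem crossExt_right (hy : IsCrossSystem I y) (ho : ∀ i, Cross I i (o i))
    (h : ¬ Cross I i l) (hil : i ≠ l) (hri : Cross I r i) (a c : A) :
    ⁅crossExt I y o i l a, y r i c⁆ = y r l (-(c * a)) := by
  have hol := (ho i).symm.trans_not h
  rw [hy.crossExt_eq_commutator ho (ho i) hol hil, hy.comm_right (ho i) hol hil hri, mul_one]

end Same

theorem crossExt_add (hy : IsCrossSystem I y) (ho : ∀ i, Cross I i (o i)) {i l : ι} (hil : i ≠ l)
    (a b : A) :
    crossExt I y o i l a * crossExt I y o i l b = crossExt I y o i l (a + b) := by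
  by_cases h : Cross I i l
  · rw [crossExt_of_cross h, crossExt_of_cross h, crossExt_of_cross h, hy.add h]
  · have hol := (ho i).symm.trans_not h
    rw [crossExt, if_neg h, crossExt, if_neg h, crossExt, if_neg h, hy.w_add_left (ho i) hol hil]

theorem crossExt_comm (hy : IsCrossSystem I y) (ho : ∀ i, Cross I i (o i)) {i j k l : ι}
    (hij : i ≠ j) (hkl : k ≠ l) (hjk : j ≠ k) (hli : l ≠ i) (a b : A) :
    Commute (crossExt I y o i j a) (crossExt I y o k l b) := by
  by_cases h : Cross I i j
  · rw [crossExt_of_cross h]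
    by_cases h' : Cross I k l
    · rw [crossExt_of_cross h']
      exact hy.comm h h' hjk hli _ _
    · exact (hy.crossExt_commute ho h' hkl h hli.symm hjk _ _).symm
  · by_cases h' : Cross I k l
    · rw [crossExt_of_cross h']
      exact hy.crossExt_commute ho h hij h' hjk.symm hli _ _
    · by_cases hki : Cross I k i
      · have hil : Cross I i l := hki.symm.trans_not h'
        have hkj : Cross I k j := hki.trans_not h
        -- The pairs (i, j) and (k, l) lie on opposite sides. Routing x_{kl}(b) through i,
        -- conjugation by x_{ij}(a) only multiplies y_{ki}(b) by y_{kj}(-ba), which commutes with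
        -- y_{il}(1).
        rw [hy.crossExt_eq_commutator ho hki hil hkl]
        refine commute_of_conj_eq ?_
        have h0 : ⁅y k j (-(b * a)), y i l 1⁆ = 1 :=
          (hy.comm hkj hil hij.symm hkl.symm _ _).commutator_eq
        rw [map_commutatorElement, conj_eq_of_commutator (hy.crossExt_right ho h hij hki a b),
          conj_eq_of_commute (hy.crossExt_commute ho h hij hil hij hli a 1), commutator_mul_left,
          h0, mul_one]
        exact (hy.comm_comm hki hil hkl hkj hkl hkj.ne.symm _ _ _).symm
      · have hol := (ho k).symm.trans_not h'
        -- All four indices are on one side, so the middle index `o k` differs from i and j, and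
        -- x_{ij}(a) commutes with both entries of the commutator.
        rw [hy.crossExt_eq_commutator ho (ho k) hol hkl]
        refine commute_commutator
          (hy.crossExt_commute ho h hij (ho k) hjk.symm ?_ _ _)
          (hy.crossExt_commute ho h hij hol ?_ hli _ _)
        · intro e
          exact hki (e ▸ ho k)
        · intro e
          exact h (Cross.of_not_left (not_cross_symm hki) (e ▸ ho k))

theorem crossExt_commutator (hy : IsCrossSystem I y) (ho : ∀ i, Cross I i (o i)) {i j l : ι}
    (hij : i ≠ j) (hjl : j ≠ l) (hil : i ≠ l) (a b : A) :
    ⁅crossExt I y o i j a, crossExt I y o j l b⁆ = crossExt I y o i l (a * b) := by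
  by_cases h : Cross I i j
  · by_cases h' : Cross I j l
    · rw [crossExt_of_cross h, crossExt_of_cross h', hy.commutator_eq_crossExt ho h h' hil]
    · have h'' := h.trans_not h'
      rw [crossExt_of_cross h, crossExt_of_cross h'', ← commutatorElement_inv,
        hy.crossExt_right ho h' hjl h, hy.neg h'', inv_inv]
  · by_cases h' : Cross I j l
    · rw [crossExt_of_cross h', crossExt_of_cross (h'.of_not_left h),
        hy.crossExt_left ho h hij h']
    · have hjm := ho j
      have hml := hjm.symm.trans_not h'
      have him := hjm.of_not_left h
      -- All three indices are on one side. Both elements are routed through the same m = `o j`, so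
      -- that conjugation by x_{ij}(a) multiplies y_{jm}(b) by y_{im}(ab) and fixes y_{ml}(1).
      rw [hy.crossExt_eq_commutator ho hjm hml hjl, hy.crossExt_eq_commutator ho him hml hil]
      refine commutator_eq_of_conj ?_
      have h1 : Commute (y i (o j) (a * b)) ⁅y j (o j) b, y (o j) l 1⁆ :=
        (hy.comm_comm hjm hml hjl him hil hjm.ne.symm _ _ _).symm
      have h2 : Commute ⁅y i (o j) (a * b), y (o j) l 1⁆ ⁅y j (o j) b, y (o j) l 1⁆ :=
        commute_commutator
          (hy.comm_comm him hml hil hjm hjl him.ne.symm _ _ _)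
          (hy.comm_comm him hml hil hml hml.ne hil.symm _ _ _)
      rw [map_commutatorElement, conj_eq_of_commutator (hy.crossExt_left ho h hij hjm a b),
        conj_eq_of_commute (hy.crossExt_commute ho h hij hml ?_ hil.symm a 1),
        commutator_mul_left h1, h2.eq]
      exact hjm.ne.symm

end IsCrossSystem

/-! ### Homomorphisms out of the linear Steinberg group -/

/-- A family in a group satisfying the relations of the linear Steinberg group. -/
structure IsSteinbergFamily {ι A G : Type*} [Ring A] [Group G] (s : ι → ι → A → G) : Prop where
  add : ∀ {i j}, i ≠ j → ∀ a b, s i j a * s i j b = s i j (a + b)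
  comm : ∀ {i j k l}, i ≠ j → k ≠ l → j ≠ k → l ≠ i → ∀ a b, Commute (s i j a) (s k l b)
  mul : ∀ {i j l}, i ≠ j → j ≠ l → i ≠ l → ∀ a b, ⁅s i j a, s j l b⁆ = s i l (a * b)

theorem IsSteinbergFamily.exists_hom {ι : Type v} {A : Type u} {G : Type w} [Ring A] [Group G]
    {s : ι → ι → A → G} (hs : IsSteinbergFamily s) :
    ∃ f : LinSt ι A →* G, ∀ i j h a, f (xLin i j h a) = s i j a := by
  refine ⟨PresentedGroup.toGroup (f := fun g : LinGen ι A => s g.1.1.1 g.1.1.2 g.2) ?_,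
    fun i j h a => PresentedGroup.toGroup.of _⟩
  intro r hr
  cases hr with
  | e1 i j h a b =>
    simp only [genLin, map_mul, map_inv, FreeGroup.lift_apply_of]
    rw [mul_inv_eq_one, hs.add h]
  | e2 i j k l hij hkl hjk hli a b =>
    simp only [genLin, map_commutatorElement, FreeGroup.lift_apply_of]
    exact (hs.comm hij hkl hjk hli a b).commutator_eq
  | e3 i j l hij hjl hil a b =>
    simp only [genLin, map_mul, map_inv, map_commutatorElement, FreeGroup.lift_apply_of]
    rw [mul_inv_eq_one, hs.mul hij hjl hil]

theorem linSt_hom_ext {ι : Type v} {A : Type u} {G : Type w} [Ring A] [Group G]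
    {f g : LinSt ι A →* G} (h : ∀ i j h a, f (xLin i j h a) = g (xLin i j h a)) : f = g :=
  PresentedGroup.ext fun x => h x.1.1.1 x.1.1.2 x.1.2 x.2

/-! ### The cross system of the Jordan-style Steinberg group -/

section Jordan

variable {ι : Type v} {I : Set ι} {A : Type u} [Ring A] [DecidableEq ι]

theorem xPlus_add (u u' : VPlus I A) : xPlus (u + u') = xPlus u * xPlus u' :=
  mul_inv_eq_one.1 (PresentedGroup.one_of_mem (JordanRel.ej1_plus u u'))

theorem xMinus_add (v v' : VMinus I A) : xMinus (v + v') = xMinus v * xMinus v' :=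
  mul_inv_eq_one.1 (PresentedGroup.one_of_mem (JordanRel.ej1_minus v v'))

theorem xPlus_zero : xPlus (0 : VPlus I A) = 1 := by
  have h := xPlus_add (0 : VPlus I A) 0
  rw [add_zero] at h
  exact mul_eq_left.1 h.symm

theorem xMinus_zero : xMinus (0 : VMinus I A) = 1 := by
  have h := xMinus_add (0 : VMinus I A) 0
  rw [add_zero] at h
  exact mul_eq_left.1 h.symm

theorem xPlus_commute (u u' : VPlus I A) : Commute (xPlus u) (xPlus u') := by
  rw [commute_iff_eq, ← xPlus_add, add_comm, xPlus_add]

theorem xMinus_commute (v v' : VMinus I A) : Commute (xMinus v) (xMinus v') := by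
  rw [commute_iff_eq, ← xMinus_add, add_comm, xMinus_add]

theorem xPlus_xMinus_commute {i k : I} {j l : (Iᶜ : Set ι)} (h : i ≠ k) (h' : j ≠ l) (a b : A) :
    Commute (xPlus (Finsupp.single (i, j) a)) (xMinus (Finsupp.single (l, k) b)) := by
  refine commutatorElement_eq_one_iff_commute.1
    (PresentedGroup.one_of_mem (JordanRel.ej2 i k j l ?_ a b))
  simp [rootInner_root, h, h']

theorem xPlus_triple {i k : I} {j l : (Iᶜ : Set ι)} (h : rootInner (root i j) (root k l) = 1)
    (a b : A) (z : VPlus I A) :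
    ⁅⁅xPlus (Finsupp.single (i, j) a), xMinus (Finsupp.single (l, k) b)⁆, xPlus z⁆ =
      xPlus (-FinMat.triple (Finsupp.single (i, j) a) (Finsupp.single (l, k) b) z) :=
  mul_inv_eq_one.1 (PresentedGroup.one_of_mem (JordanRel.ej3_plus i k j l h a b z))

theorem xMinus_triple {i k : I} {j l : (Iᶜ : Set ι)} (h : rootInner (root i j) (root k l) = 1)
    (a b : A) (z : VMinus I A) :
    ⁅⁅xMinus (Finsupp.single (j, i) a), xPlus (Finsupp.single (k, l) b)⁆, xMinus z⁆ =
      xMinus (-FinMat.triple (Finsupp.single (j, i) a) (Finsupp.single (k, l) b) z) :=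
  mul_inv_eq_one.1 (PresentedGroup.one_of_mem (JordanRel.ej3_minus i k j l h a b z))

theorem triple_single {I J : Type*} [DecidableEq I] [DecidableEq J] (i k r : I) (j l s : J)
    (a b c : A) :
    FinMat.triple (Finsupp.single (i, j) a) (Finsupp.single (l, k) b) (Finsupp.single (r, s) c) =
      (if j = l ∧ k = r then Finsupp.single (i, s) (a * b * c) else 0) +
      (if s = l ∧ k = i then Finsupp.single (r, j) (c * b * a) else 0) := by
  rw [FinMat.triple, FinMat.mul_single, FinMat.mul_single]
  congr 1
  · by_cases h : j = l
    · simp only [h, if_true, true_and, FinMat.mul_single]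
    · simp [h, FinMat.zero_mul]
  · by_cases h : s = l
    · simp only [h, if_true, true_and, FinMat.mul_single]
    · simp [h, FinMat.zero_mul]

open Classical in
variable (I A) in
/-- The elements `x_{ij}(a)`, for `i` and `j` on different sides, of the Jordan-style Steinberg
group. -/
def jordanCross (i j : ι) (a : A) : JordanSt I A :=
  if h : i ∈ I ∧ j ∉ I then xPlus (Finsupp.single (⟨i, h.1⟩, ⟨j, h.2⟩) a)
  -- The sign matches the convention of Φ, which sends x_-(v) to the product of the x_{ji}(-v_{ji}).
  else if h : i ∉ I ∧ j ∈ I then xMinus (Finsupp.single (⟨i, h.1⟩, ⟨j, h.2⟩) (-a))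
  else 1

theorem jordanCross_plus (i : I) (j : (Iᶜ : Set ι)) (a : A) :
    jordanCross I A i j a = xPlus (Finsupp.single (i, j) a) := by
  rw [jordanCross, dif_pos ⟨i.2, j.2⟩]

theorem jordanCross_minus (i : I) (j : (Iᶜ : Set ι)) (a : A) :
    jordanCross I A j i a = xMinus (Finsupp.single (j, i) (-a)) := by
  rw [jordanCross, dif_neg (fun h => j.2 h.1), dif_pos ⟨j.2, i.2⟩]

omit [DecidableEq ι] in
theorem Cross.exists_eq {i j : ι} (h : Cross I i j) :
    (∃ (p : I) (q : (Iᶜ : Set ι)), i = p ∧ j = q) ∨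
      ∃ (p : I) (q : (Iᶜ : Set ι)), i = q ∧ j = p := by
  by_cases hi : i ∈ I
  · exact Or.inl ⟨⟨i, hi⟩, ⟨j, h.1 hi⟩, rfl, rfl⟩
  · exact Or.inr ⟨⟨j, by unfold Cross at h; tauto⟩, ⟨i, hi⟩, rfl, rfl⟩

/-- With r on the side of i, the outer element has the sign of the first entry, so (EJ3) applies
directly. Only one of the two terms of the triple product can be non-zero, since i ≠ l. -/
theorem jordanCross_comm_same {i j l r s : ι} (hij : Cross I i j) (hjl : Cross I j l)
    (hil : i ≠ l) (hrs : Cross I r s) (hri : ¬ Cross I r i) (a b c : A) :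
    ⁅⁅jordanCross I A i j a, jordanCross I A j l b⁆, jordanCross I A r s c⁆ =
      if l = r then jordanCross I A i s (a * b * c) else 1 := by
  rcases hij.exists_eq with ⟨i, j, rfl, rfl⟩ | ⟨j, i, rfl, rfl⟩
  · rcases hjl.exists_eq with ⟨_, _, h, -⟩ | ⟨l, j', h, rfl⟩
    · exact absurd h (ne_of_mem _ _).symm
    obtain rfl := Subtype.ext h
    rcases hrs.exists_eq with ⟨r, s, rfl, rfl⟩ | ⟨s, r, rfl, rfl⟩
    · have hil' : i ≠ l := fun e => hil (congrArg _ e)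
      have hr : rootInner (root i j) (root l j) = 1 := by simp [rootInner_root, hil']
      rw [jordanCross_plus, jordanCross_minus, jordanCross_plus, jordanCross_plus,
        xPlus_triple hr, triple_single]
      by_cases hlr : l = r
      · simp [hlr, hlr ▸ hil'.symm]
      · simp [hlr, hil'.symm, Subtype.coe_ne_coe.2 hlr, xPlus_zero]
    · exact (hri (by have h2 : (r : ι) ∉ I := r.2; simp [Cross, h2])).elim
  · rcases hjl.exists_eq with ⟨j', l, h, rfl⟩ | ⟨_, _, h, -⟩
    · obtain rfl := Subtype.ext h
      rcases hrs.exists_eq with ⟨r, s, rfl, rfl⟩ | ⟨s, r, rfl, rfl⟩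
      · exact (hri (by have h2 : (i : ι) ∉ I := i.2; simp [Cross, h2])).elim
      · have hil' : i ≠ l := fun e => hil (congrArg _ e)
        have hr : rootInner (root j i) (root j l) = 1 := by simp [rootInner_root, hil']
        rw [jordanCross_plus, jordanCross_minus, jordanCross_minus, jordanCross_minus,
          xMinus_triple hr, triple_single]
        by_cases hlr : l = r
        · simp [hlr, hlr ▸ hil'.symm]
        · simp [hlr, hil'.symm, Subtype.coe_ne_coe.2 hlr, xMinus_zero]
    · exact absurd h (ne_of_mem _ _)

/-- With r on the side of j, the outer element has the sign of x_{jl}(b). The inner commutator is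
therefore reversed, to bring it into the form required by (EJ3). -/
theorem jordanCross_comm_opposite {i j l r s : ι} (hij : Cross I i j) (hjl : Cross I j l)
    (hil : i ≠ l) (hrs : Cross I r s) (hri : Cross I r i) (a b c : A) :
    ⁅⁅jordanCross I A j l b, jordanCross I A i j a⁆, jordanCross I A r s c⁆ =
      if s = i then jordanCross I A r l (c * a * b) else 1 := by
  rcases hij.exists_eq with ⟨i, j, rfl, rfl⟩ | ⟨j, i, rfl, rfl⟩
  · rcases hjl.exists_eq with ⟨_, _, h, -⟩ | ⟨l, j', h, rfl⟩
    · exact absurd h (ne_of_mem _ _).symm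
    obtain rfl := Subtype.ext h
    rcases hrs.exists_eq with ⟨r, s, rfl, rfl⟩ | ⟨s, r, rfl, rfl⟩
    · exact absurd hri (by simp [Cross])
    · have hil' : i ≠ l := fun e => hil (congrArg _ e)
      have hr : rootInner (root l j) (root i j) = 1 := by simp [rootInner_root, hil'.symm]
      rw [jordanCross_plus, jordanCross_minus, jordanCross_minus, jordanCross_minus,
        xMinus_triple hr, triple_single]
      by_cases hsi : s = i
      · simp [hsi, hil'.symm]
      · simp [hsi, hil'.symm, Subtype.coe_ne_coe.2 hsi, xMinus_zero]
  · rcases hjl.exists_eq with ⟨j', l, h, rfl⟩ | ⟨_, _, h, -⟩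
    · obtain rfl := Subtype.ext h
      rcases hrs.exists_eq with ⟨r, s, rfl, rfl⟩ | ⟨s, r, rfl, rfl⟩
      · have hil' : i ≠ l := fun e => hil (congrArg _ e)
        have hr : rootInner (root j l) (root j i) = 1 := by simp [rootInner_root, hil'.symm]
        rw [jordanCross_plus, jordanCross_minus, jordanCross_plus, jordanCross_plus,
          xPlus_triple hr, triple_single]
        by_cases hsi : s = i
        · simp [hsi, hil'.symm]
        · simp [hsi, hil'.symm, Subtype.coe_ne_coe.2 hsi, xPlus_zero]
      · exact absurd hri (by have h1 := i.2; have h2 := r.2; simp_all [Cross])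
    · exact absurd h (ne_of_mem _ _)

theorem jordanCross_add {i j : ι} (h : Cross I i j) (a b : A) :
    jordanCross I A i j (a + b) = jordanCross I A i j a * jordanCross I A i j b := by
  rcases h.exists_eq with ⟨i, j, rfl, rfl⟩ | ⟨j, i, rfl, rfl⟩
  · simp only [jordanCross_plus, Finsupp.single_add, xPlus_add]
  · simp only [jordanCross_minus, neg_add, Finsupp.single_add, xMinus_add]

theorem jordanCross_neg {i j : ι} (h : Cross I i j) (a : A) :
    jordanCross I A i j (-a) = (jordanCross I A i j a)⁻¹ := by
  have h0 := jordanCross_add h (0 : A) 0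
  rw [add_zero, left_eq_mul] at h0
  rw [eq_inv_iff_mul_eq_one, ← jordanCross_add h, neg_add_cancel, h0]

theorem jordanCross_comm_comm {i j l r s : ι} (hij : Cross I i j) (hjl : Cross I j l)
    (hil : i ≠ l) (hrs : Cross I r s) (hrl : r ≠ l) (hsi : s ≠ i) (a b c : A) :
    Commute ⁅jordanCross I A i j a, jordanCross I A j l b⁆ (jordanCross I A r s c) := by
  by_cases hri : Cross I r i
  · rw [← commutatorElement_inv]
    refine Commute.inv_left (commutatorElement_eq_one_iff_commute.1 ?_)
    rw [jordanCross_comm_opposite hij hjl hil hrs hri, if_neg hsi]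
  · refine commutatorElement_eq_one_iff_commute.1 ?_
    rw [jordanCross_comm_same hij hjl hil hrs hri, if_neg hrl.symm]

variable (I A) in
theorem isCrossSystem_jordanCross : IsCrossSystem I (jordanCross I A) where
  add := jordanCross_add
  comm := by
    intro i j k l hij hkl hjk hli a b
    rcases hij.exists_eq with ⟨i, j, rfl, rfl⟩ | ⟨j, i, rfl, rfl⟩ <;>
    rcases hkl.exists_eq with ⟨k, l, rfl, rfl⟩ | ⟨l, k, rfl, rfl⟩
    · simp only [jordanCross_plus]
      exact xPlus_commute _ _
    · simp only [jordanCross_plus, jordanCross_minus]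
      exact xPlus_xMinus_commute (fun e => hli (congrArg _ e.symm)) (fun e => hjk (congrArg _ e)) _ _
    · simp only [jordanCross_plus, jordanCross_minus]
      exact (xPlus_xMinus_commute (fun e => hjk (congrArg _ e.symm))
        (fun e => hli (congrArg _ e)) _ _).symm
    · simp only [jordanCross_minus]
      exact xMinus_commute _ _
  comm_comm := jordanCross_comm_comm
  comm_left := by
    intro i j l s hij hjl hil hls a b c
    rw [jordanCross_comm_same hij hjl hil hls (hij.ne_of_cross hjl |> not_cross_symm), if_pos rfl]
  comm_right := by
    intro i j l r hij hjl hil hri a b c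
    -- This concerns the reversed inner commutator; inverting it inverts the outer value, which
    -- accounts for the minus sign.
    have h := jordanCross_comm_opposite hij hjl hil hri hri a b c
    have hrl := hri.trans hij hjl
    rw [if_pos rfl] at h
    rw [← commutatorElement_inv (jordanCross I A j l b), commutator_inv_left_of_commutator h,
      jordanCross_neg hrl]
    rw [← commutatorElement_inv]
    exact (jordanCross_comm_comm hij hjl hil hrl (hri.trans hij hjl).ne hil.symm _ _ _).inv_left

-- Only the values on cross pairs are recorded: they determine the homomorphism, since same-side
-- generators are commutators of cross ones.
variable (I A) in
theorem exists_Phi_inverse (hI : I.Nonempty) (hI' : I ≠ Set.univ) :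
    ∃ f : LinSt ι A →* JordanSt I A,
      ∀ i j (h : i ≠ j) (a : A), Cross I i j → f (xLin i j h a) = jordanCross I A i j a := by
  choose o ho using exists_cross hI hI'
  have hy := isCrossSystem_jordanCross I A
  have hs : IsSteinbergFamily (crossExt I (jordanCross I A) o) :=
    ⟨hy.crossExt_add ho, hy.crossExt_comm ho, hy.crossExt_commutator ho⟩
  obtain ⟨f, hf⟩ := hs.exists_hom
  exact ⟨f, fun i j h a hij => by rw [hf, IsCrossSystem.crossExt_of_cross hij]⟩

theorem finsupp_hom_eq {κ B G : Type*} [AddCommGroup B] [Group G] (x y : (κ →₀ B) → G)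
    (hx : ∀ u u', x (u + u') = x u * x u') (hy : ∀ u u', y (u + u') = y u * y u')
    (h : ∀ p b, x (Finsupp.single p b) = y (Finsupp.single p b)) (u : κ →₀ B) : x u = y u := by
  have zero : ∀ z : (κ →₀ B) → G, (∀ u u', z (u + u') = z u * z u') → z 0 = 1 := fun z hz => by
    have := hz 0 0
    rw [add_zero] at this
    exact mul_eq_left.1 this.symm
  induction u using Finsupp.induction_linear with
  | zero => rw [zero x hx, zero y hy]
  | single p b => exact h p b
  | add u u' ih ih' => rw [hx, hy, ih, ih']

theorem Phi_bijective (hI : I.Nonempty) (hI' : I ≠ Set.univ) :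
    Function.Bijective (Phi I A) := by
  obtain ⟨f, hf⟩ := exists_Phi_inverse I A hI hI'
  have hcross : ∀ (i : I) (j : (Iᶜ : Set ι)), Cross I i j := fun i j => by
    have h1 := i.2
    have h2 : (j : ι) ∉ I := j.2
    simp [Cross, h2]
  have h1 : f.comp (Phi I A) = MonoidHom.id _ := by
    refine PresentedGroup.ext ?_
    rintro (u | v)
    · change f (Phi I A (xPlus u)) = xPlus u
      rw [Phi_xPlus]
      refine finsupp_hom_eq (fun u => f (xPlus' u)) xPlus
        (fun _ _ => by rw [xPlus'_add, map_mul]) xPlus_add ?_ u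
      rintro ⟨i, j⟩ a
      rw [xPlus'_single, hf _ _ _ _ (hcross i j), jordanCross_plus]
    · change f (Phi I A (xMinus v)) = xMinus v
      rw [Phi_xMinus]
      refine finsupp_hom_eq (fun v => f (xMinus' v)) xMinus
        (fun _ _ => by rw [xMinus'_add, map_mul]) xMinus_add ?_ v
      rintro ⟨j, i⟩ a
      rw [xMinus'_single, hf _ _ _ _ (hcross i j).symm, jordanCross_minus, neg_neg]
  have hΦ : ∀ i j (h : i ≠ j) (a : A), Cross I i j →
      Phi I A (jordanCross I A i j a) = xLin i j h a := by
    intro i j h a hij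
    rcases hij.exists_eq with ⟨i, j, rfl, rfl⟩ | ⟨j, i, rfl, rfl⟩
    · rw [jordanCross_plus, Phi_xPlus, xPlus'_single]
    · rw [jordanCross_minus, Phi_xMinus, xMinus'_single, neg_neg]
  have h2 : (Phi I A).comp f = MonoidHom.id _ := by
    refine linSt_hom_ext fun i j h a => ?_
    change Phi I A (f (xLin i j h a)) = xLin i j h a
    by_cases hij : Cross I i j
    · rw [hf _ _ _ _ hij, hΦ _ _ h _ hij]
    -- A same-side generator is a commutator of two cross generators through k, on which the
    -- composite is already known to be the identity.
    · obtain ⟨k, hik⟩ := exists_cross hI hI' i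
      have hkj := hik.symm.trans_not hij
      rw [← mul_one a, ← xLin_comm' i k j hik.ne hkj.ne h a 1, map_commutatorElement,
        map_commutatorElement, hf _ _ _ _ hik, hf _ _ _ _ hkj, hΦ _ _ _ _ hik, hΦ _ _ _ _ hkj]
  exact ⟨Function.LeftInverse.injective (g := f) (DFunLike.congr_fun h1),
    Function.RightInverse.surjective (g := f) (DFunLike.congr_fun h2)⟩

end Jordan

/-! ### Lifting homomorphisms along central extensions -/

section CentralExtension

variable {E G : Type*} [Group E] [Group G] {p : E →* G}

/-- Entries with the same image differ by a central factor, which cancels in a commutator. This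
makes commutators of lifts canonical, and it drives both existence and uniqueness below. -/
theorem IsCentralExtension.commutator_congr (hp : IsCentralExtension p) {x x' y y' : E}
    (hx : p x = p x') (hy : p y = p y') : ⁅x, y⁆ = ⁅x', y'⁆ := by
  have key : ∀ {x x' : E} (y : E), p x = p x' → ⁅x, y⁆ = ⁅x', y⁆ := by
    intro x x' y h
    have hz : x * x'⁻¹ ∈ Subgroup.center E := hp.2 (by rw [MonoidHom.mem_ker, map_mul, h, map_inv,
      mul_inv_cancel])
    have hc : ∀ g, Commute (x * x'⁻¹) g := fun g => ((Subgroup.mem_center_iff.1 hz) g).symm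
    rw [← inv_mul_cancel_right x x', commutator_mul_left (hc _), (hc y).commutator_eq, mul_one]
  rw [key y hx, ← commutatorElement_inv, key x' hy, commutatorElement_inv]

theorem IsCentralExtension.commute_congr (hp : IsCentralExtension p) {x x' y : E}
    (hx : p x = p x') (h : Commute x y) : Commute x' y := by
  rw [commute_iff_eq, ← commutatorElement_eq_one_iff_mul_comm, ← hp.commutator_congr hx rfl,
    h.commutator_eq]

/-- Conjugation by z changes x and y only inside their fibres, so `commutator_congr` leaves the
commutator fixed. -/
theorem IsCentralExtension.commute_commutator (hp : IsCentralExtension p) {x y z : E}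
    (hxy : Commute (p z) (p x)) (hxz : Commute (p z) (p y)) : Commute z ⁅x, y⁆ := by
  refine commute_of_conj_eq ?_
  rw [map_commutatorElement]
  refine hp.commutator_congr ?_ ?_
  · rw [MulAut.conj_apply, map_mul, map_mul, map_inv, hxy.eq, mul_inv_cancel_right]
  · rw [MulAut.conj_apply, map_mul, map_mul, map_inv, hxz.eq, mul_inv_cancel_right]

/-- A special case of the Hall–Witt phenomenon: apply v⁻¹, u⁻¹, v, u successively to x by
conjugation; with e = [u, [v, x]] the hypotheses reduce the result to e·x. -/
theorem commutator_commutator_assoc {u v x : E} (hux : Commute u x) (hv : Commute v ⁅v, x⁆)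
    (he : Commute u ⁅u, ⁅v, x⁆⁆) (he' : Commute v ⁅u, ⁅v, x⁆⁆)
    (he'' : Commute ⁅v, x⁆ ⁅u, ⁅v, x⁆⁆) : ⁅⁅u, v⁆, x⁆ = ⁅u, ⁅v, x⁆⁆ := by
  refine commutator_eq_of_conj ?_
  have h1 : MulAut.conj v⁻¹ x = ⁅v, x⁆⁻¹ * x :=
    conj_eq_of_commutator (commutator_inv_left_of_commutator rfl hv)
  have h2 : MulAut.conj u⁻¹ ⁅v, x⁆ = ⁅u, ⁅v, x⁆⁆⁻¹ * ⁅v, x⁆ :=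
    conj_eq_of_commutator (commutator_inv_left_of_commutator rfl he)
  have h3 : MulAut.conj ⁅u, v⁆ x =
      MulAut.conj u (MulAut.conj v (MulAut.conj u⁻¹ (MulAut.conj v⁻¹ x))) := by
    simp [commutatorElement_def, mul_assoc]
  rw [h3, h1, map_mul, map_inv, h2, conj_eq_of_commute hux.inv_left]
  simp only [map_mul, map_inv, conj_eq_of_commute hv, conj_eq_of_commute he',
    conj_eq_of_commutator (rfl : ⁅v, x⁆ = _), conj_eq_of_commute he, conj_eq_of_commute hux,
    conj_eq_of_commutator (rfl : ⁅u, ⁅v, x⁆⁆ = _), mul_inv_rev, inv_inv]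
  rw [inv_mul_cancel_right, he''.eq.symm, mul_assoc, inv_mul_cancel_left]

end CentralExtension

section Lift

variable {ι A E G : Type*} [Ring A] [Group E] [Group G] {p : E →* G} {t : ι → ι → A → G}

/-- Elements of `E` over commuting root elements commute. -/
theorem IsSteinbergFamily.commute_of_lift (hp : IsCentralExtension p) (ht : IsSteinbergFamily t)
    (hι : ∀ i j k l : ι, ∃ m, m ≠ i ∧ m ≠ j ∧ m ≠ k ∧ m ≠ l) {i j k l : ι} (hij : i ≠ j)
    (hkl : k ≠ l) (hjk : j ≠ k) (hli : l ≠ i) {a b : A} {x y : E} (hx : p x = t i j a)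
    (hy : p y = t k l b) : Commute x y := by
  -- A fifth index is needed here: x agrees modulo the kernel with a commutator of lifts of
  -- t_{im}(a) and t_{mj}(1), and the image of y commutes with both.
  obtain ⟨m, hmi, hmj, hmk, hml⟩ := hι i j k l
  obtain ⟨u, hu⟩ := hp.1 (t i m a)
  obtain ⟨v, hv⟩ := hp.1 (t m j 1)
  have h1 : p ⁅u, v⁆ = p x := by
    rw [map_commutatorElement, hu, hv, ht.mul hmi.symm hmj hij, mul_one, hx]
  refine hp.commute_congr h1 (Commute.symm (hp.commute_commutator ?_ ?_))
  · rw [hy, hu]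
    exact ht.comm hkl hmi.symm hli hmk _ _
  · rw [hy, hv]
    exact ht.comm hkl hmj hml.symm hjk _ _

/-- Choose z over t_{jk}(b). Then v may be replaced by [z, y] and x by [u, z], and the claim becomes
[u, [z, y]] = [[u, z], y]. -/
theorem IsSteinbergFamily.commutator_lift_assoc (hp : IsCentralExtension p)
    (ht : IsSteinbergFamily t) (hι : ∀ i j k l : ι, ∃ m, m ≠ i ∧ m ≠ j ∧ m ≠ k ∧ m ≠ l)
    {i j k l : ι} (hij : i ≠ j) (hjk : j ≠ k) (hkl : k ≠ l) (hik : i ≠ k) (hil : i ≠ l)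
    (hjl : j ≠ l) {a b c : A} {u v x y : E} (hu : p u = t i j a) (hv : p v = t j l (b * c))
    (hx : p x = t i k (a * b)) (hy : p y = t k l c) : ⁅u, v⁆ = ⁅x, y⁆ := by
  obtain ⟨z, hz⟩ := hp.1 (t j k b)
  have h1 : p ⁅z, y⁆ = t j l (b * c) := by rw [map_commutatorElement, hz, hy, ht.mul hjk hkl hjl]
  have h2 : p ⁅u, z⁆ = t i k (a * b) := by rw [map_commutatorElement, hz, hu, ht.mul hij hjk hik]
  have h3 : p ⁅u, ⁅z, y⁆⁆ = t i l (a * (b * c)) := by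
    rw [map_commutatorElement, hu, h1, ht.mul hij hjl hil]
  rw [hp.commutator_congr (x' := u) (y' := ⁅z, y⁆) rfl (hv.trans h1.symm),
    hp.commutator_congr (x' := ⁅u, z⁆) (y' := y) (hx.trans h2.symm) rfl,
    commutator_commutator_assoc]
  · exact ht.commute_of_lift hp hι hij hkl hjk hil.symm hu hy
  · exact ht.commute_of_lift hp hι hjk hjl hjk.symm hjl.symm hz h1
  · exact ht.commute_of_lift hp hι hij hil hij.symm hil.symm hu h3
  · exact ht.commute_of_lift hp hι hjk hil hik.symm hjl.symm hz h3
  · exact ht.commute_of_lift hp hι hjl hil hil.symm hjl.symm h1 h3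

theorem IsSteinbergFamily.commutator_lift_add_left (hp : IsCentralExtension p)
    (ht : IsSteinbergFamily t) (hι : ∀ i j k l : ι, ∃ m, m ≠ i ∧ m ≠ j ∧ m ≠ k ∧ m ≠ l)
    {i j l : ι} (hij : i ≠ j) (hjl : j ≠ l) (hil : i ≠ l) {a a' b : A} {u u' v x : E}
    (hu : p u = t i j a) (hu' : p u' = t i j a') (hx : p x = t i j (a + a'))
    (hv : p v = t j l b) : ⁅u, v⁆ * ⁅u', v⁆ = ⁅x, v⁆ := by
  have h1 : p (u' * u) = p x := by rw [map_mul, hu, hu', ht.add hij, hx, add_comm]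
  rw [← hp.commutator_congr h1 rfl, commutator_mul_left]
  refine ht.commute_of_lift hp hι hij hil hij.symm hil.symm hu' ?_ (b := a * b)
  rw [map_commutatorElement, hu, hv, ht.mul hij hjl hil]

theorem IsSteinbergFamily.exists_lift (hp : IsCentralExtension p) (ht : IsSteinbergFamily t)
    (hι : ∀ i j k l : ι, ∃ m, m ≠ i ∧ m ≠ j ∧ m ≠ k ∧ m ≠ l) :
    ∃ s : ι → ι → A → E, IsSteinbergFamily s ∧ ∀ i j, i ≠ j → ∀ a, p (s i j a) = t i j a := by
  choose σ hσ using hp.1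
  choose o ho using fun i l => hι i l i l
  have hoi := fun i l => (ho i l).1
  have hol := fun i l => (ho i l).2.1
  -- The raw section σ satisfies no relations, but this commutator does not depend on its choice.
  set s : ι → ι → A → E := fun i l a => ⁅σ (t i (o i l) a), σ (t (o i l) l 1)⁆ with hs
  have hlift : ∀ i l, i ≠ l → ∀ a, p (s i l a) = t i l a := fun i l h a => by
    rw [hs, map_commutatorElement, hσ, hσ, ht.mul (hoi i l).symm (hol i l) h, mul_one]
  have hindep : ∀ i j l, i ≠ j → j ≠ l → i ≠ l → ∀ a b,
      ⁅σ (t i j a), σ (t j l b)⁆ = s i l (a * b) := by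
    have h1 : ∀ i j k l, i ≠ j → j ≠ k → k ≠ l → i ≠ k → i ≠ l → j ≠ l → ∀ a b c,
        ⁅σ (t i j a), σ (t j l (b * c))⁆ = ⁅σ (t i k (a * b)), σ (t k l c)⁆ :=
      fun i j k l hij hjk hkl hik hil hjl a b c =>
        ht.commutator_lift_assoc hp hι hij hjk hkl hik hil hjl (hσ _) (hσ _) (hσ _) (hσ _)
    have h2 : ∀ i j k l, i ≠ j → k ≠ l → i ≠ k → i ≠ l → j ≠ l → ∀ a b,
        ⁅σ (t i j a), σ (t j l b)⁆ = ⁅σ (t i k a), σ (t k l b)⁆ := by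
      intro i j k l hij hkl hik hil hjl a b
      rcases eq_or_ne j k with rfl | hjk
      · rfl
      · have := h1 i j k l hij hjk hkl hik hil hjl a 1 b
        rwa [one_mul, mul_one] at this
    intro i j l hij hjl hil a b
    obtain ⟨k, hki, hkj, hkl, -⟩ := hι i j l l
    -- Taking c = 1 moves b into the left entry at the price of changing j to k; `h2`, the case
    -- where the middle coefficient is 1, then changes k to `o i l`. The index k must avoid j, hence
    -- the detour.
    have h3 := h1 i j k l hij hkj.symm hkl hki.symm hil hjl a b 1
    rw [mul_one] at h3
    rw [h3]
    exact h2 i k (o i l) l hki.symm (hol i l) (hoi i l).symm hil hkl _ _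
  refine ⟨s, ⟨?_, ?_, ?_⟩, hlift⟩
  · intro i j hij a b
    exact ht.commutator_lift_add_left hp hι (hoi i j).symm (hol i j) hij (hσ _) (hσ _) (hσ _) (hσ _)
  · intro i j k l hij hkl hjk hli a b
    exact ht.commute_of_lift hp hι hij hkl hjk hli (hlift i j hij a) (hlift k l hkl b)
  · intro i j l hij hjl hil a b
    rw [← hindep i j l hij hjl hil]
    exact hp.commutator_congr ((hlift _ _ hij _).trans (hσ _).symm)
      ((hlift _ _ hjl _).trans (hσ _).symm)

end Lift

theorem isSteinbergFamily_xLin {ι A : Type*} [Ring A] [DecidableEq ι] :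
    IsSteinbergFamily fun (i j : ι) (a : A) => if h : i ≠ j then xLin i j h a else 1 where
  add := by
    intro i j h a b
    simp only [dif_pos h, xLin_mul]
  comm := by
    intro i j k l hij hkl hjk hli a b
    simp only [dif_pos hij, dif_pos hkl]
    exact commutatorElement_eq_one_iff_commute.1 (xLin_comm i j k l hij hkl hjk hli a b)
  mul := by
    intro i j l hij hjl hil a b
    simp only [dif_pos hij, dif_pos hjl, dif_pos hil]
    exact xLin_comm' i j l hij hjl hil a b

theorem IsSteinbergFamily.map {ι A G H : Type*} [Ring A] [Group G] [Group H] {t : ι → ι → A → G}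
    (ht : IsSteinbergFamily t) (f : G →* H) : IsSteinbergFamily fun i j a => f (t i j a) where
  add h a b := by rw [← map_mul, ht.add h]
  comm hij hkl hjk hli a b := (ht.comm hij hkl hjk hli a b).map f
  mul hij hjl hil a b := by rw [← map_commutatorElement, ht.mul hij hjl hil]

/-- Homomorphisms from the linear Steinberg group of rank at least 5 lift uniquely along central
extensions. -/
theorem linSt_existsUnique_lift {ι A E G : Type*} [Ring A] [Group E] [Group G]
    {p : E →* G} (hp : IsCentralExtension p)
    (hι : ∀ i j k l : ι, ∃ m, m ≠ i ∧ m ≠ j ∧ m ≠ k ∧ m ≠ l) (q : LinSt ι A →* G) :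
    ∃! f : LinSt ι A →* E, q = p.comp f := by
  classical
  obtain ⟨s, hs, hps⟩ := (isSteinbergFamily_xLin.map q).exists_lift hp hι
  obtain ⟨f, hf⟩ := hs.exists_hom
  have hqf : q = p.comp f := linSt_hom_ext fun i j h a => by
    rw [MonoidHom.comp_apply, hf, hps i j h, dif_pos h]
  refine ⟨f, hqf, fun g hg => linSt_hom_ext fun i j h a => ?_⟩
  have hpg : ∀ x, p (g x) = p (f x) := fun x => DFunLike.congr_fun (hg.symm.trans hqf) x
  -- Each generator is a commutator, so two lifts of q agree on it by `commutator_congr`.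
  obtain ⟨m, hmi, hmj, -, -⟩ := hι i j i j
  rw [← mul_one a, ← xLin_comm' i m j hmi.symm hmj h a 1, map_commutatorElement,
    map_commutatorElement]
  exact hp.commutator_congr (hpg _) (hpg _)

/-! ### Transport of the lifting property along Φ -/

section Jordan

variable {ι : Type v} {I : Set ι} {A : Type u} [Ring A] [DecidableEq ι]

theorem jordanSt_existsUnique_lift {E G : Type*} [Group E] [Group G] {p : E →* G}
    (hp : IsCentralExtension p) (hI : I.Nonempty) (hI' : I ≠ Set.univ)
    (hι : ∀ i j k l : ι, ∃ m, m ≠ i ∧ m ≠ j ∧ m ≠ k ∧ m ≠ l) (q : JordanSt I A →* G) :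
    ∃! f : JordanSt I A →* E, q = p.comp f := by
  let e : JordanSt I A ≃* LinSt ι A := MulEquiv.ofBijective (Phi I A) (Phi_bijective hI hI')
  obtain ⟨f, hf, hu⟩ := linSt_existsUnique_lift hp hι (q.comp e.symm.toMonoidHom)
  refine ⟨f.comp e.toMonoidHom, ?_, fun g hg => ?_⟩
  · refine MonoidHom.ext fun x => ?_
    have := DFunLike.congr_fun hf (e x)
    simpa using this
  · rw [← hu (g.comp e.symm.toMonoidHom)]
    · refine MonoidHom.ext fun x => ?_
      simp
    · rw [hg, MonoidHom.comp_assoc]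

theorem isCentralExtension_id (X : Type*) [Group X] : IsCentralExtension (MonoidHom.id X) :=
  ⟨Function.surjective_id, by
    intro x hx
    rw [MonoidHom.mem_ker, MonoidHom.id_apply] at hx
    rw [hx]
    exact Subgroup.one_mem _⟩

end Jordan

theorem exists_ne_of_five_le {ι : Type*} (h : 5 ≤ ENat.card ι) (i j k l : ι) :
    ∃ m, m ≠ i ∧ m ≠ j ∧ m ≠ k ∧ m ≠ l := by
  classical
  by_contra hn
  push Not at hn
  have hu : (Set.univ : Set ι) ⊆ (({i, j, k, l} : Finset ι) : Set ι) := by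
    intro m _
    have := hn m
    simp only [Finset.coe_insert, Finset.coe_singleton, Set.mem_insert_iff, Set.mem_singleton_iff]
    tauto
  have h1 := Set.encard_le_encard hu
  rw [Set.encard_univ, Set.encard_coe_eq_coe_finsetCard] at h1
  have h2 : (({i, j, k, l} : Finset ι).card : ℕ∞) ≤ 4 := by exact_mod_cast Finset.card_le_four
  exact absurd ((h.trans h1).trans h2) (by decide)

/-! ### The kernel of `℘` -/

section Kernel

variable {ι : Type v} [DecidableEq ι] {I : Set ι} {A : Type u} [Ring A]

theorem wp_xLin_mul_apply (i j : ι) (h : i ≠ j) (a : A) (g : LinSt ι A) (p q : ι) :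
    (wp ι A (xLin i j h a * g)).1.1.1 p q =
      (wp ι A g).1.1.1 p q + if i = p then a * (wp ι A g).1.1.1 j q else 0 := by
  rw [map_mul, wp_xLin]
  exact elemMat_mul_apply i j a _ p q

theorem wp_one_apply (p q : ι) : (wp ι A 1).1.1.1 p q = (1 : Matrix ι ι A) p q := by
  rw [map_one]
  rfl

/-- The image is the block unipotent matrix with upper right block u. The rows indexed by J are
carried along because left multiplication by an elementary matrix adds a multiple of such a row. -/
theorem wp_xPlus'_apply (u : VPlus I A) :
    (∀ (p : (Iᶜ : Set ι)) (q : ι), (wp ι A (xPlus' u)).1.1.1 p q = (1 : Matrix ι ι A) p q) ∧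
      ∀ (i : I) (j : (Iᶜ : Set ι)), (wp ι A (xPlus' u)).1.1.1 i j = u (i, j) := by
  induction u using Finsupp.induction with
  | zero =>
    rw [xPlus'_zero]
    simp only [wp_one_apply]
    exact ⟨fun _ _ => trivial, fun i j => Matrix.one_apply_ne (ne_of_mem i j)⟩
  | single_add p a u _ _ ih =>
    obtain ⟨i, j⟩ := p
    rw [xPlus'_add, xPlus'_single]
    simp only [wp_xLin_mul_apply, ih.1, ih.2]
    refine ⟨fun p q => ?_, fun k l => ?_⟩
    · rw [if_neg (ne_of_mem i p), add_zero]
    · simp only [Finsupp.add_apply, Finsupp.single_apply, Prod.mk.injEq, Matrix.one_apply,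
        Subtype.coe_inj]
      by_cases h1 : i = k <;> by_cases h2 : j = l <;> simp [h1, h2, add_comm]

theorem wp_xMinus'_apply (v : VMinus I A) :
    (∀ (p : I) (q : ι), (wp ι A (xMinus' v)).1.1.1 p q = (1 : Matrix ι ι A) p q) ∧
      ∀ (j : (Iᶜ : Set ι)) (i : I), (wp ι A (xMinus' v)).1.1.1 j i = -v (j, i) := by
  induction v using Finsupp.induction with
  | zero =>
    rw [xMinus'_zero]
    simp only [wp_one_apply]
    exact ⟨fun _ _ => trivial, fun j i => by simp [Matrix.one_apply_ne (ne_of_mem i j).symm]⟩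
  | single_add p a v _ _ ih =>
    obtain ⟨j, i⟩ := p
    rw [xMinus'_add, xMinus'_single]
    simp only [wp_xLin_mul_apply, ih.1, ih.2]
    refine ⟨fun p q => ?_, fun l k => ?_⟩
    · rw [if_neg (ne_of_mem p j).symm, add_zero]
    · simp only [Finsupp.add_apply, Finsupp.single_apply, Prod.mk.injEq, Matrix.one_apply,
        Subtype.coe_inj]
      by_cases h1 : j = l <;> by_cases h2 : i = k <;> simp [h1, h2]

theorem wp_xPlus'_injective {u u' : VPlus I A} (h : wp ι A (xPlus' u) = wp ι A (xPlus' u')) :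
    u = u' := by
  ext ⟨i, j⟩
  rw [← (wp_xPlus'_apply u).2, h, (wp_xPlus'_apply u').2]

theorem wp_xMinus'_injective {v v' : VMinus I A}
    (h : wp ι A (xMinus' v) = wp ι A (xMinus' v')) : v = v' := by
  ext ⟨j, i⟩
  rw [← neg_inj, ← (wp_xMinus'_apply v).2, h, (wp_xMinus'_apply v').2]

variable (I A) in
/-- The abelian subgroup `x'_+(V⁺)`. -/
def plusSubgroup : Subgroup (LinSt ι A) where
  carrier := Set.range (xPlus' : VPlus I A → LinSt ι A)
  mul_mem' := by
    rintro _ _ ⟨u, rfl⟩ ⟨u', rfl⟩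
    exact ⟨u + u', xPlus'_add u u'⟩
  one_mem' := ⟨0, xPlus'_zero⟩
  inv_mem' := by
    rintro _ ⟨u, rfl⟩
    exact ⟨-u, xPlus'_neg u⟩

variable (I A) in
/-- The abelian subgroup `x'_-(V⁻)`. -/
def minusSubgroup : Subgroup (LinSt ι A) where
  carrier := Set.range (xMinus' : VMinus I A → LinSt ι A)
  mul_mem' := by
    rintro _ _ ⟨u, rfl⟩ ⟨u', rfl⟩
    exact ⟨u + u', xMinus'_add u u'⟩
  one_mem' := ⟨0, xMinus'_zero⟩
  inv_mem' := by
    rintro _ ⟨u, rfl⟩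
    exact ⟨-u, xMinus'_neg u⟩

omit [DecidableEq ι] in
theorem xLin_mem_plusSubgroup (i : I) (j : (Iᶜ : Set ι)) (h : (i : ι) ≠ j) (a : A) :
    xLin (i : ι) j h a ∈ plusSubgroup I A :=
  ⟨_, xPlus'_single i j a⟩

omit [DecidableEq ι] in
theorem xLin_mem_minusSubgroup (i : I) (j : (Iᶜ : Set ι)) (h : (j : ι) ≠ i) (a : A) :
    xLin (j : ι) i h a ∈ minusSubgroup I A :=
  ⟨Finsupp.single (j, i) (-a), by rw [xMinus'_single, neg_neg]⟩

/-- For i and j both in I, x_{ij}(a) acts like a block diagonal matrix, and block diagonal matrices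
normalize the unipotent block. -/
theorem conj_xLin_mem_plusSubgroup (i j : I) (h : (i : ι) ≠ j) (a : A) (u : VPlus I A) :
    MulAut.conj (xLin (i : ι) j h a) (xPlus' u) ∈ plusSubgroup I A := by
  induction u using Finsupp.induction_linear with
  | zero =>
    rw [xPlus'_zero, map_one]
    exact Subgroup.one_mem _
  | add u u' ih ih' =>
    rw [xPlus'_add, map_mul]
    exact Subgroup.mul_mem _ ih ih'
  | single p b =>
    obtain ⟨k, l⟩ := p
    rw [xPlus'_single]
    by_cases hk : j = k
    · subst hk
      rw [conj_eq_of_commutator (xLin_comm' _ _ _ _ _ (ne_of_mem i l) _ _)]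
      exact Subgroup.mul_mem _ (xLin_mem_plusSubgroup _ _ _ _) (xLin_mem_plusSubgroup _ _ _ _)
    · rw [conj_eq_of_commute (commutatorElement_eq_one_iff_commute.1
        (xLin_comm _ _ _ _ _ _ (fun e => hk (Subtype.ext e)) (ne_of_mem i l).symm _ _))]
      exact xLin_mem_plusSubgroup _ _ _ _

theorem conj_xLin_mem_minusSubgroup (i j : I) (h : (i : ι) ≠ j) (a : A) (v : VMinus I A) :
    MulAut.conj (xLin (i : ι) j h a) (xMinus' v) ∈ minusSubgroup I A := by
  induction v using Finsupp.induction_linear with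
  | zero =>
    rw [xMinus'_zero, map_one]
    exact Subgroup.one_mem _
  | add u u' ih ih' =>
    rw [xMinus'_add, map_mul]
    exact Subgroup.mul_mem _ ih ih'
  | single p b =>
    obtain ⟨l, k⟩ := p
    rw [xMinus'_single]
    by_cases hk : k = i
    · subst hk
      rw [conj_eq_of_commutator (xLin_comm'' _ _ _ _ _ (ne_of_mem j l).symm _ _)]
      exact Subgroup.mul_mem _ (xLin_mem_minusSubgroup _ _ _ _) (xLin_mem_minusSubgroup _ _ _ _)
    · rw [conj_eq_of_commute (commutatorElement_eq_one_iff_commute.1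
        (xLin_comm _ _ _ _ _ _ (ne_of_mem j l) (fun e => hk (Subtype.ext e)) _ _))]
      exact xLin_mem_minusSubgroup _ _ _ _

theorem mem_normalizer_of_conj_mem {G : Type*} [Group G] {H : Subgroup G} {g : G}
    (h : ∀ x ∈ H, MulAut.conj g x ∈ H) (h' : ∀ x ∈ H, MulAut.conj g⁻¹ x ∈ H) :
    g ∈ Subgroup.normalizer (H : Set G) := by
  refine Subgroup.mem_normalizer_iff.2 fun x => ⟨h x, fun hx => ?_⟩
  have := h' _ hx
  simpa [mul_assoc] using this

/-- S collects the indices in a word for g. For n outside S, every letter has both indices in I =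
{n}ᶜ, so it normalizes both subgroups. -/
theorem exists_finset_mem_normalizer (g : LinSt ι A) : ∃ S : Finset ι, ∀ n, n ∉ S →
    g ∈ Subgroup.normalizer (plusSubgroup ({n}ᶜ : Set ι) A : Set (LinSt ι A)) ⊓
      Subgroup.normalizer (minusSubgroup ({n}ᶜ : Set ι) A : Set (LinSt ι A)) := by
  have hg : g ∈ Subgroup.closure (Set.range (PresentedGroup.of :
      LinGen ι A → LinSt ι A)) := by
    rw [PresentedGroup.closure_range_of]
    trivial
  induction hg using Subgroup.closure_induction with
  | mem x hx =>
    obtain ⟨⟨⟨⟨i, j⟩, h⟩, a⟩, rfl⟩ := hx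
    refine ⟨{i, j}, fun n hn => ?_⟩
    simp only [Finset.mem_insert, Finset.mem_singleton, not_or] at hn
    change xLin i j h a ∈ _
    have hi : i ∈ ({n}ᶜ : Set ι) := fun e => hn.1 (Eq.symm e)
    have hj : j ∈ ({n}ᶜ : Set ι) := fun e => hn.2 (Eq.symm e)
    refine ⟨mem_normalizer_of_conj_mem ?_ ?_, mem_normalizer_of_conj_mem ?_ ?_⟩
    · rintro _ ⟨u, rfl⟩
      exact conj_xLin_mem_plusSubgroup ⟨i, hi⟩ ⟨j, hj⟩ h a u
    · rintro _ ⟨u, rfl⟩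
      rw [← xLin_neg]
      exact conj_xLin_mem_plusSubgroup ⟨i, hi⟩ ⟨j, hj⟩ h (-a) u
    · rintro _ ⟨u, rfl⟩
      exact conj_xLin_mem_minusSubgroup ⟨i, hi⟩ ⟨j, hj⟩ h a u
    · rintro _ ⟨u, rfl⟩
      rw [← xLin_neg]
      exact conj_xLin_mem_minusSubgroup ⟨i, hi⟩ ⟨j, hj⟩ h (-a) u
  | one => exact ⟨∅, fun n _ => Subgroup.one_mem _⟩
  | mul x y _ _ hx hy =>
    obtain ⟨S, hS⟩ := hx
    obtain ⟨T, hT⟩ := hy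
    refine ⟨S ∪ T, fun n hn => ?_⟩
    simp only [Finset.mem_union, not_or] at hn
    exact Subgroup.mul_mem _ (hS n hn.1) (hT n hn.2)
  | inv x _ hx =>
    obtain ⟨S, hS⟩ := hx
    exact ⟨S, fun n hn => Subgroup.inv_mem _ (hS n hn)⟩

variable (ι A) in
/-- In infinite rank, the kernel of `℘` is central. -/
theorem ker_wp_le_center [Infinite ι] : (wp ι A).ker ≤ Subgroup.center (LinSt ι A) := by
  intro g hg
  rw [MonoidHom.mem_ker] at hg
  obtain ⟨S, hS⟩ := exists_finset_mem_normalizer g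
  obtain ⟨n, hn⟩ := Infinite.exists_notMem_finset S
  obtain ⟨h1, h2⟩ := hS n hn
  have hwp : ∀ x, wp ι A (g * x * g⁻¹) = wp ι A x := fun x => by simp [hg]
  have hplus : ∀ u : VPlus ({n}ᶜ : Set ι) A, Commute g (xPlus' u) := fun u => by
    obtain ⟨u', hu'⟩ := (Subgroup.mem_normalizer_iff.1 h1 (xPlus' u)).1 ⟨u, rfl⟩
    -- The conjugate of x'_+(u) is some x'_+(u') with the same image under ℘, hence u' = u.
    have := wp_xPlus'_injective (hu' ▸ hwp (xPlus' u))
    subst this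
    exact commute_of_conj_eq hu'.symm
  have hminus : ∀ v : VMinus ({n}ᶜ : Set ι) A, Commute g (xMinus' v) := fun v => by
    obtain ⟨v', hv'⟩ := (Subgroup.mem_normalizer_iff.1 h2 (xMinus' v)).1 ⟨v, rfl⟩
    have := wp_xMinus'_injective (hv' ▸ hwp (xMinus' v))
    subst this
    exact commute_of_conj_eq hv'.symm
  have hne : ({n}ᶜ : Set ι).Nonempty := by
    obtain ⟨m, hm⟩ := exists_ne n
    exact ⟨m, hm⟩
  -- Surjectivity of Φ for this auxiliary partition says that the elements x'_±(u) generate the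
  -- Steinberg group.
  have hΦ := (Phi_bijective (A := A) hne (fun h => (h ▸ Set.mem_univ n : n ∈ ({n}ᶜ : Set ι)) rfl)).2
  refine Subgroup.mem_center_iff.2 fun x => ?_
  obtain ⟨y, rfl⟩ := hΦ x
  have hy : y ∈ Subgroup.closure (Set.range (PresentedGroup.of :
      JordanGen ({n}ᶜ : Set ι) A → JordanSt ({n}ᶜ : Set ι) A)) := by
    rw [PresentedGroup.closure_range_of]
    trivial
  suffices Commute g (Phi _ A y) from this.symm.eq
  induction hy using Subgroup.closure_induction with
  | mem x hx =>
    obtain ⟨u | v, rfl⟩ := hx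
    · exact Phi_xPlus u ▸ hplus u
    · exact Phi_xMinus v ▸ hminus v
  | one =>
    rw [map_one]
    exact Commute.one_right g
  | mul x y _ _ hx hy =>
    rw [map_mul]
    exact hx.mul_right hy
  | inv x _ hx =>
    rw [map_inv]
    exact hx.inv_right

variable (ι A) in
theorem wp_surjective : Function.Surjective (wp ι A) := by
  have h : EL ι A ≤ ((EL ι A).subtype.comp (wp ι A)).range := by
    refine (Subgroup.closure_le _).2 ?_
    rintro _ ⟨i, j, h, a, rfl⟩
    exact ⟨xLin i j h a, by rw [MonoidHom.comp_apply, wp_xLin]; rfl⟩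
  rintro ⟨g, hg⟩
  obtain ⟨x, hx⟩ := h hg
  exact ⟨x, Subtype.ext hx⟩

theorem isCentralExtension_pHom [Infinite ι] (hI : I.Nonempty) (hI' : I ≠ Set.univ) :
    IsCentralExtension (pHom I A) := by
  have hΦ := Phi_bijective (A := A) hI hI'
  refine ⟨(wp_surjective ι A).comp hΦ.2, fun x hx => Subgroup.mem_center_iff.2 fun y => ?_⟩
  have h := Subgroup.mem_center_iff.1 (ker_wp_le_center ι A (show Phi I A x ∈ _ from hx))
    (Phi I A y)
  rw [← map_mul, ← map_mul] at h
  exact hΦ.1 h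

end Kernel

end JordanSteinberg

end

theorem theorem1p6 (A : Type u) [Ring A] (N : Set ℕ)
    (hN : (∃ n : ℕ, 3 ≤ n ∧ N = Set.Icc 1 n) ∨ N = Set.univ)
    (I : Set N) (hI : I.Nonempty) (hIN : I ≠ Set.univ) :
    Function.Bijective (JordanSteinberg.Phi I A) ∧
    (5 ≤ N.encard → JordanSteinberg.IsCentrallyClosed.{u, w} (JordanSteinberg.JordanSt I A)) ∧
    (N = Set.univ → JordanSteinberg.IsUniversalCentralExtension.{u, u, w}
      (JordanSteinberg.pHom I A)) := by
  refine ⟨JordanSteinberg.Phi_bijective hI hIN, fun h5 => ?_, fun hu => ?_⟩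
  · exact ⟨JordanSteinberg.isCentralExtension_id _, fun E _ p hp =>
      JordanSteinberg.jordanSt_existsUnique_lift hp hI hIN
        (JordanSteinberg.exists_ne_of_five_le h5) _⟩
  · have : Infinite N := Set.infinite_coe_iff.2 (hu ▸ Set.infinite_univ)
    exact ⟨JordanSteinberg.isCentralExtension_pHom hI hIN, fun E _ p hp =>
      JordanSteinberg.jordanSt_existsUnique_lift hp hI hIN
        (JordanSteinberg.exists_ne_of_five_le (by simp)) _⟩
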